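/- **Setting.** All vector spaces are finite-dimensional over $\mathbb C$. For vectors of $V$ put $v_1\circ\dots\circ v_d=\frac1{d!}\sum_{\tau\in\mathfrak S_d}v_{\tau(1)}\otimes\dots\otimes v_{\tau(d)}$ and $v_1\wedge\dots\wedge v_d=\frac1{d!}\sum_{\tau\in\mathfrak S_d}\operatorname{sgn}(\tau)\,v_{\tau(1)}\otimes\dots\otimes v_{\tau(d)}$ in $V^{\otimes d}$. For a subset $X$ of the projective space of a tensor space $E$ let $\widehat X\subseteq E$ be its affine cone (with $0$) and $\operatorname{span}(X)$ the linear span of $\widehat X$. The $X$-rank $\operatorname{rank}_X(p)$ of $p\in\operatorname{span}(X)$ is the least $r$ such that $p$ is a sum of $r$ elements of $\widehat X$. For a Hermitian inner product on $E$ with norm $\|\cdot\|$, $\Sigma_r(X)$ is the closure of $\{p:\operatorname{rank}_X(p)\le r\}$; the border rank $\overline{\operatorname{rank}}_X(p)$ is the least $r$ with $p\in\Sigma_r(X)$, and the generic rank $r_g(X)$ is the least $r$ with $\Sigma_r(X)=\operatorname{span}(X)$. **Theorem.** Let $X$ be one of the following varieties, each the set of classes $[x]$ of the nonzero tensors $x$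 of the given form. 1. Segre: $v_1\otimes\dots\otimes v_d$, $v_i\in V_i$, where $d\ge3$ and $\dim V_i\ge2$. 2. Veronese: $v^{\otimes d}$, $v\in V$, where $d\ge3$. 3. Chow: $v_1\circ\dots\circ v_d$, $v_i\in V$, where $d\ge3$, and $d\ge6$ if $\dim V=3$. 4. Grassmann: $v_1\wedge\dots\wedge v_k$, $v_i\in V$, where $k\ge3$ and $\dim V\ge k+3$. 5. Segre–Veronese: $v_1^{\otimes d_1}\otimes\dots\otimes v_m^{\otimes d_m}$, $v_i\in V_i$, where $m\ge3$, $d_i\ge1$, $\dim V_i\ge2$. 6. Segre–Chow: $\bigotimes_{i=1}^m(v_{1,i}\circ\dots\circ v_{d_i,i})$, $v_{j,i}\in V_i$, where $m\ge3$, $d_i\ge1$, $\dim V_i\ge2$. 7. Segre–Grassmann: $\bigotimes_{i=1}^m(v_{1,i}\wedge\dots\wedge v_{k_i,i})$, $v_{j,i}\in V_i$, where $m\ge3$, $1\le k_i<\dim V_i$. 8. Veronese–Chow: $(v_1\circ\dots\circ v_d)^{\otimes k}$, $v_i\in V$, where $d,k\ge3$. 9. Veronese–Grassmann: $(v_1\wedge\dots\wedge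 v_k)^{\otimes d}$, $v_i\in V$, where $d,k\ge3$. 10. Segre–Veronese–Chow: $\bigotimes_{i=1}^m(v_{1,i}\circ\dots\circ v_{d_i,i})^{\otimes k_i}$, $v_{j,i}\in V_i$, where $m\ge3$, $d_i,k_i\ge1$, $\dim V_i\ge2$. 11. Segre–Veronese–Grassmann: $\bigotimes_{i=1}^m(v_{1,i}\wedge\dots\wedge v_{k_i,i})^{\otimes d_i}$, $v_{j,i}\in V_i$, where $m\ge3$, $d_i\ge1$, $1\le k_i<\dim V_i$. Fix any Hermitian inner product on the ambient tensor space, and assume that $r_g(X)>2$. (No $A\in\operatorname{span}(X)$ can lack a best $X$-rank-$r$ approximation for $r\le1$, so the conclusion is false if $r_g(X)\le2$.) Then there are a tensor $A\in\operatorname{span}(X)$ and an $r<r_g(X)$, namely $r=2$, such that $\overline{\operatorname{rank}}_X(A)=2<\operatorname{rank}_X(A)$ and $A$ has no best $X$-rank-$r$ approximation: the infimum $$\inf_{\operatorname{rank}_X(B)\le r}\|A-B\|$$ is not attained by any $B\in\operatorname{span}(X)$ with $\operatorname{rank}_X(B)\le r$. -/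

import Mathlib

open scoped TensorProduct LinearAlgebra.Projectivization

universe u

noncomputable section

namespace XRank

section General

variable {E : Type*} [AddCommGroup E] [Module ℂ E]

/-- The image in `ℙ E` of the map `a ↦ [f a]`, where `a` runs over the parameters with `f a ≠ 0`. -/
def projImage {ι : Type*} (f : ι → E) : Set (ℙ ℂ E) :=
  {p | ∃ (a : ι) (h : f a ≠ 0), p = Projectivization.mk ℂ (f a) h}

/-- The affine cone `π⁻¹(X) ∪ {0}` of `X ⊆ ℙ E`. -/
def affineCone (X : Set (ℙ ℂ E)) : Set E :=
  {x | ∃ h : x ≠ 0, Projectivization.mk ℂ x h ∈ X} ∪ {0}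

/-- The linear span of `X ⊆ ℙ E`, a subspace of `E`. -/
def linSpan (X : Set (ℙ ℂ E)) : Submodule ℂ E :=
  Submodule.span ℂ (affineCone X)

/-- `Σ_r°(X)`: the sums of `r` points of the affine cone of `X`. -/
def secantPoints (X : Set (ℙ ℂ E)) (r : ℕ) : Set E :=
  {p | ∃ x : Fin r → E, (∀ i, x i ∈ affineCone X) ∧ p = ∑ i, x i}

/-- The `X`-rank of `p`: the least `r` such that `p` is a sum of `r` points of the affine cone of
`X` (and `⊤` if there is none, i.e. if `p` is not in the span of `X`). -/
def xrank (X : Set (ℙ ℂ E)) (p : E) : ℕ∞ :=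
  ⨅ r ∈ {r : ℕ | p ∈ secantPoints X r}, (r : ℕ∞)

/-- The norm of a Hermitian inner product on `E`. -/
def hnorm (c : InnerProductSpace.Core ℂ E) (x : E) : ℝ :=
  Real.sqrt (c.inner x x).re

/-- The Euclidean closure of a set, for the norm of a Hermitian inner product on `E`. -/
def euclClosure (c : InnerProductSpace.Core ℂ E) (S : Set E) : Set E :=
  {p | ∀ ε > 0, ∃ q ∈ S, hnorm c (p - q) < ε}

/-- `Σ_r(X)`: the `r`-th secant variety (as an affine cone), the Euclidean closure of `Σ_r°(X)`. -/
def secantVariety (c : InnerProductSpace.Core ℂ E) (X : Set (ℙ ℂ E)) (r : ℕ) : Set E :=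
  euclClosure c (secantPoints X r)

/-- The border `X`-rank of `p`: the least `r` such that `p` is a limit of points of `X`-rank at
most `r`. -/
def borderRank (c : InnerProductSpace.Core ℂ E) (X : Set (ℙ ℂ E)) (p : E) : ℕ∞ :=
  ⨅ r ∈ {r : ℕ | p ∈ secantVariety c X r}, (r : ℕ∞)

/-- The generic `X`-rank: the least `r` such that the `r`-th secant variety is the whole
linear span of `X`. -/
def genericRank (c : InnerProductSpace.Core ℂ E) (X : Set (ℙ ℂ E)) : ℕ∞ :=
  ⨅ r ∈ {r : ℕ | secantVariety c X r = linSpan X}, (r : ℕ∞)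

/-- The tensors in the span of `X` of `X`-rank at most `r`. -/
def rankAtMost (X : Set (ℙ ℂ E)) (r : ℕ) : Set E :=
  {B | B ∈ linSpan X ∧ xrank X B ≤ r}

/-- `A` has a best `X`-rank-`r` approximation: the infimum of `‖A - B‖` over all `B` in the span
of `X` with `X`-rank at most `r` is attained. -/
def HasBestApprox (c : InnerProductSpace.Core ℂ E) (X : Set (ℙ ℂ E)) (r : ℕ) (A : E) : Prop :=
  ∃ B ∈ rankAtMost X r, IsMinOn (fun B => hnorm c (A - B)) (rankAtMost X r) B

/-- The failure of best approximation for `X`: for `r = 2`, which is below the generic rank, some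
`A` in the span of `X`, of border `X`-rank `2` and `X`-rank greater than `2`, has no best
`X`-rank-`r` approximation. -/
def BestApproxFails (c : InnerProductSpace.Core ℂ E) (X : Set (ℙ ℂ E)) : Prop :=
  ∃ A ∈ linSpan X, ∃ r : ℕ, r = 2 ∧ (r : ℕ∞) < genericRank c X ∧
    borderRank c X A = r ∧ r < xrank X A ∧ ¬ HasBestApprox c X r A

end General

section Products

variable {V : Type*} [AddCommGroup V] [Module ℂ V]

/-- The tensor power `v^{⊗ d}`. -/
def tpow (d : ℕ) (v : V) : ⨂[ℂ] _ : Fin d, V :=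
  PiTensorProduct.tprod ℂ fun _ => v

/-- The symmetric product `v₁ ∘ ⋯ ∘ v_d`, a symmetric tensor in `V^{⊗ d}`. -/
def symProd {d : ℕ} (v : Fin d → V) : ⨂[ℂ] _ : Fin d, V :=
  ((d.factorial : ℂ)⁻¹) •
    ∑ τ : Equiv.Perm (Fin d), PiTensorProduct.tprod ℂ fun i => v (τ i)

/-- The alternating product `v₁ ∧ ⋯ ∧ v_d`, an alternating tensor in `V^{⊗ d}`.
It is nonzero if and only if the `v_i` are linearly independent. -/
def altProd {d : ℕ} (v : Fin d → V) : ⨂[ℂ] _ : Fin d, V :=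
  ((d.factorial : ℂ)⁻¹) •
    ∑ τ : Equiv.Perm (Fin d),
      ((Equiv.Perm.sign τ : ℤ) : ℂ) • PiTensorProduct.tprod ℂ fun i => v (τ i)

end Products

section OneSpace

variable (V : Type*) [AddCommGroup V] [Module ℂ V]

/-- Veronese variety, in `ℙ(S^d V) ⊆ ℙ(V^{⊗ d})`. -/
def veronese (d : ℕ) : Set (ℙ ℂ (⨂[ℂ] _ : Fin d, V)) :=
  projImage fun v : V => tpow d v

/-- Chow variety, in `ℙ(S^d V) ⊆ ℙ(V^{⊗ d})`. -/
def chow (d : ℕ) : Set (ℙ ℂ (⨂[ℂ] _ : Fin d, V)) :=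
  projImage fun v : Fin d → V => symProd v

/-- Grassmann variety of `k`-dimensional subspaces in its Plücker embedding,
in `ℙ(Λ^k V) ⊆ ℙ(V^{⊗ k})`. -/
def grassmann (k : ℕ) : Set (ℙ ℂ (⨂[ℂ] _ : Fin k, V)) :=
  projImage fun v : Fin k → V => altProd v

/-- Veronese-Chow variety, in `ℙ(S^k(S^d V)) ⊆ ℙ((V^{⊗ d})^{⊗ k})`. -/
def veroneseChow (d k : ℕ) : Set (ℙ ℂ (⨂[ℂ] _ : Fin k, ⨂[ℂ] _ : Fin d, V)) :=
  projImage fun v : Fin d → V => tpow k (symProd v)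

/-- Veronese-Grassmann variety, in `ℙ(S^d(Λ^k V)) ⊆ ℙ((V^{⊗ k})^{⊗ d})`. -/
def veroneseGrassmann (d k : ℕ) : Set (ℙ ℂ (⨂[ℂ] _ : Fin d, ⨂[ℂ] _ : Fin k, V)) :=
  projImage fun v : Fin k → V => tpow d (altProd v)

end OneSpace

section ManySpaces

variable {m : ℕ} (V : Fin m → Type*) [∀ i, AddCommGroup (V i)] [∀ i, Module ℂ (V i)]

/-- Segre variety, in `ℙ(V₁ ⊗ ⋯ ⊗ V_m)`. -/
def segre : Set (ℙ ℂ (⨂[ℂ] i, V i)) :=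
  projImage fun v : ∀ i, V i => PiTensorProduct.tprod ℂ v

/-- Segre-Veronese variety, in `ℙ(S^{d₁} V₁ ⊗ ⋯ ⊗ S^{d_m} V_m)`. -/
def segreVeronese (d : Fin m → ℕ) : Set (ℙ ℂ (⨂[ℂ] i, ⨂[ℂ] _ : Fin (d i), V i)) :=
  projImage fun v : ∀ i, V i => PiTensorProduct.tprod ℂ fun i => tpow (d i) (v i)

/-- Segre-Chow variety, in `ℙ(S^{d₁} V₁ ⊗ ⋯ ⊗ S^{d_m} V_m)`. -/
def segreChow (d : Fin m → ℕ) : Set (ℙ ℂ (⨂[ℂ] i, ⨂[ℂ] _ : Fin (d i), V i)) :=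
  projImage fun v : ∀ i, Fin (d i) → V i => PiTensorProduct.tprod ℂ fun i => symProd (v i)

/-- Segre-Grassmann variety, in `ℙ(Λ^{k₁} V₁ ⊗ ⋯ ⊗ Λ^{k_m} V_m)`. -/
def segreGrassmann (k : Fin m → ℕ) : Set (ℙ ℂ (⨂[ℂ] i, ⨂[ℂ] _ : Fin (k i), V i)) :=
  projImage fun v : ∀ i, Fin (k i) → V i => PiTensorProduct.tprod ℂ fun i => altProd (v i)

/-- Segre-Veronese-Chow variety, in `ℙ(S^{k₁}(S^{d₁} V₁) ⊗ ⋯ ⊗ S^{k_m}(S^{d_m} V_m))`. -/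
def segreVeroneseChow (d k : Fin m → ℕ) :
    Set (ℙ ℂ (⨂[ℂ] i, ⨂[ℂ] _ : Fin (k i), ⨂[ℂ] _ : Fin (d i), V i)) :=
  projImage fun v : ∀ i, Fin (d i) → V i =>
    PiTensorProduct.tprod ℂ fun i => tpow (k i) (symProd (v i))

/-- Segre-Veronese-Grassmann variety, in `ℙ(S^{d₁}(Λ^{k₁} V₁) ⊗ ⋯ ⊗ S^{d_m}(Λ^{k_m} V_m))`. -/
def segreVeroneseGrassmann (d k : Fin m → ℕ) :
    Set (ℙ ℂ (⨂[ℂ] i, ⨂[ℂ] _ : Fin (d i), ⨂[ℂ] _ : Fin (k i), V i)) :=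
  projImage fun v : ∀ i, Fin (k i) → V i =>
    PiTensorProduct.tprod ℂ fun i => tpow (d i) (altProd (v i))

end ManySpaces

end XRank

end

/-!
For every variety `X` of the theorem the tensor `A` without a best approximation of rank two is a
tangent vector at `t = 0` of a curve in the affine cone. The difference quotients exhibit `A` as a
limit of sums of two points of the cone, so the infimum of the distances is `0`
(`HasWeakDeriv.mem_secantVariety`), and by `bestApproxFails_of` it remains to choose the curve so
that `A` is neither a limit of points of the cone nor a sum of two of them.

*Tensor products.* All families made of at least three tensor factors, and the families of powers
of order at least three, are contained in a Segre variety. Take a curve `f₁(t) ⊗ ⋯ ⊗ f_m(t)` in the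
cone whose factors have independent position and velocity at `0`. Functionals dual to these map `A`
to the tensor `W` of format `2 × 2 × 2`, which is a limit of tensors of rank two but has rank three
(`w_tensor_not_rank_two`, `bestApproxFails_of_segre`). When no such curve exists, the cone is at
most a line and the generic rank at most `1`.

*Grassmann varieties.* The three-term Plücker relations show that a decomposition of the tangent
vector `f₀ ∧ e₁ ∧ e₂ ∧ ⋯ + e₀ ∧ f₁ ∧ e₂ ∧ ⋯ + e₀ ∧ e₁ ∧ f₂ ∧ ⋯` into two decomposable tensors would
have `e₀` in both of the subspaces involved, so that `f₀ ∧ e₁ ∧ e₂ ∧ ⋯` could not occur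
(`bestApproxFails_grassmann`).

*Chow varieties.* The cone is closed (`secantVariety_chow_one`), and a symmetric tensor may be
tested as a form on the dual space, so what is needed is a tangent form that is not a sum of two
products of linear forms. In dimension at most two every form is a product of linear forms, and the
generic rank is at most `1`. In dimension at least four, at the product `x^{d-2} y z` there is the
tangent form `x^{d-3} (w y z + x z² + x² y)`. In dimension three and degree `d ≥ 6`, at the product
`w (y^{d-1} - x^{d-1})`, there is `w² x^{d-2} + w x³ y^{d-4} + y^d - y x^{d-1}`. The main case of a
decomposition of the latter is that all linear forms involve `w`. At `y = 1` they are then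
`w - (a + b x)` up to scalars, and the identity of the coefficients, through Newton's identities,
prescribes moments `∑ ± a^i b^j` over the `2 d` points `(a, b)`, the sign being that of the product
to which a point belongs. Most moments vanish, which makes a space of functions of dimension `d` in
`a, b`, linear in `b`, isotropic for the form `∑ ± f g`. Hence there is a relation `p(a) b = q(a)`
of low degree at all of the points, and it contradicts the two nonzero moments `∑ ± a^d` and
`∑ ± a^{d-4} b³` (`moments_contradiction`).
-/

noncomputable section

namespace XRank

open Filter Topology

/-! ### Cones, sums of points of the cone, and the rank -/

section Cone

variable {E : Type*} [AddCommGroup E] [Module ℂ E]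

lemma mem_affineCone_projImage {ι : Type*} {f : ι → E} {x : E} :
    x ∈ affineCone (projImage f) ↔ x = 0 ∨ ∃ a, ∃ c : ℂ, x = c • f a := by
  constructor
  · rintro (⟨hx, a, ha, h⟩ | h)
    · rw [Projectivization.mk_eq_mk_iff] at h
      obtain ⟨c, hc⟩ := h
      exact Or.inr ⟨a, c, hc.symm⟩
    · exact Or.inl h
  · rintro (h | ⟨a, c, h⟩)
    · exact Or.inr h
    · by_cases hx : x = 0
      · exact Or.inr hx
      · have hfa : f a ≠ 0 := by
          rintro h0
          exact hx (by rw [h, h0, smul_zero])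
        refine Or.inl ⟨hx, a, hfa, ?_⟩
        rw [Projectivization.mk_eq_mk_iff']
        exact ⟨c, h.symm⟩

lemma smul_mem_affineCone {ι : Type*} (f : ι → E) (c : ℂ) (a : ι) :
    c • f a ∈ affineCone (projImage f) :=
  mem_affineCone_projImage.2 (Or.inr ⟨a, c, rfl⟩)

lemma zero_mem_affineCone (X : Set (ℙ ℂ E)) : (0 : E) ∈ affineCone X := Or.inr rfl

lemma mem_secantPoints_one {X : Set (ℙ ℂ E)} {p : E} :
    p ∈ secantPoints X 1 ↔ p ∈ affineCone X := by
  constructor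
  · rintro ⟨x, hx, rfl⟩
    simpa using hx 0
  · intro h
    exact ⟨fun _ => p, fun _ => h, by simp⟩

lemma mem_secantPoints_two {X : Set (ℙ ℂ E)} {p : E} :
    p ∈ secantPoints X 2 ↔ ∃ x ∈ affineCone X, ∃ y ∈ affineCone X, p = x + y := by
  constructor
  · rintro ⟨x, hx, rfl⟩
    exact ⟨x 0, hx 0, x 1, hx 1, by simp⟩
  · rintro ⟨x, hx, y, hy, rfl⟩
    refine ⟨![x, y], fun i => ?_, by simp⟩
    fin_cases i <;> simpa

lemma secantPoints_mono (X : Set (ℙ ℂ E)) : Monotone (secantPoints X) := by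
  refine monotone_nat_of_le_succ fun r => ?_
  rintro p ⟨x, hx, rfl⟩
  refine ⟨Fin.cons 0 x, fun i => ?_, by simp [Fin.sum_univ_succ]⟩
  refine Fin.cases ?_ (fun j => ?_) i
  · simpa using zero_mem_affineCone X
  · simpa using hx j

lemma secantPoints_subset_linSpan (X : Set (ℙ ℂ E)) (r : ℕ) :
    secantPoints X r ⊆ linSpan X := by
  rintro p ⟨x, hx, rfl⟩
  exact Submodule.sum_mem _ fun i _ => Submodule.subset_span (hx i)

lemma mem_secantPoints_of_xrank_le {X : Set (ℙ ℂ E)} {p : E} {r : ℕ} (h : xrank X p ≤ r) :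
    p ∈ secantPoints X r := by
  by_contra hp
  have h1 : ((r + 1 : ℕ) : ℕ∞) ≤ xrank X p := by
    refine le_iInf₂ fun s hs => ?_
    have : r < s := by
      by_contra hsr
      exact hp (secantPoints_mono X (not_lt.1 hsr) hs)
    exact_mod_cast this
  have h2 : ((r + 1 : ℕ) : ℕ∞) ≤ r := h1.trans h
  have h3 : r + 1 ≤ r := by exact_mod_cast h2
  omega

lemma xrank_le_of_mem {X : Set (ℙ ℂ E)} {p : E} {r : ℕ} (h : p ∈ secantPoints X r) :
    xrank X p ≤ r :=
  iInf₂_le r h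

end Cone

/-! ### Secant varieties, generic rank, and a criterion for the failure of best approximation -/

section Closure

variable {E : Type*} [AddCommGroup E] [Module ℂ E]

/-- `euclClosure` is the closure in the metric topology attached to the inner product. -/
lemma mem_euclClosure_iff (c : InnerProductSpace.Core ℂ E) (S : Set E) (p : E) :
    p ∈ euclClosure c S ↔
      letI : NormedAddCommGroup E := c.toNormedAddCommGroup
      p ∈ closure S := by
  let : NormedAddCommGroup E := c.toNormedAddCommGroup
  rw [Metric.mem_closure_iff]
  refine forall₂_congr fun ε _ => exists_congr fun q => and_congr Iff.rfl ?_
  rw [dist_eq_norm]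
  rfl

lemma continuous_dual [FiniteDimensional ℂ E] (c : InnerProductSpace.Core ℂ E)
    (φ : Module.Dual ℂ E) :
    letI : NormedAddCommGroup E := c.toNormedAddCommGroup
    Continuous φ := by
  let : NormedAddCommGroup E := c.toNormedAddCommGroup
  let : InnerProductSpace ℂ E := InnerProductSpace.ofCore c.toCore
  exact LinearMap.continuous_of_finiteDimensional φ

lemma euclClosure_mono (c : InnerProductSpace.Core ℂ E) {S T : Set E} (h : S ⊆ T) :
    euclClosure c S ⊆ euclClosure c T :=
  fun _ hp ε hε => (hp ε hε).imp fun _ hq => ⟨h hq.1, hq.2⟩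

lemma subset_euclClosure (c : InnerProductSpace.Core ℂ E) (S : Set E) : S ⊆ euclClosure c S := by
  intro p hp
  rw [mem_euclClosure_iff]
  let : NormedAddCommGroup E := c.toNormedAddCommGroup
  exact subset_closure hp

lemma euclClosure_submodule [FiniteDimensional ℂ E] (c : InnerProductSpace.Core ℂ E)
    (W : Submodule ℂ E) {S : Set E} (h : S ⊆ W) : euclClosure c S ⊆ W := by
  intro p hp
  rw [mem_euclClosure_iff] at hp
  let : NormedAddCommGroup E := c.toNormedAddCommGroup
  let : InnerProductSpace ℂ E := InnerProductSpace.ofCore c.toCore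
  have hcl : IsClosed (W : Set E) := W.closed_of_finiteDimensional
  exact hcl.closure_subset_iff.2 h hp

/-- A polynomial relation between the values of finitely many functionals survives passing to
the closure; the relation is given by any continuous function `F`. -/
lemma eq_zero_of_mem_euclClosure [FiniteDimensional ℂ E] (c : InnerProductSpace.Core ℂ E)
    {κ : Type*} (φ : κ → Module.Dual ℂ E) (F : (κ → ℂ) → ℂ) (hF : Continuous F)
    {S : Set E} (hS : ∀ x ∈ S, F (fun k => φ k x) = 0) {p : E} (hp : p ∈ euclClosure c S) :
    F (fun k => φ k p) = 0 := by
  rw [mem_euclClosure_iff] at hp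
  let : NormedAddCommGroup E := c.toNormedAddCommGroup
  have hc : Continuous fun x : E => F (fun k => φ k x) :=
    hF.comp (continuous_pi fun k => continuous_dual c (φ k))
  have hcl : IsClosed {x : E | F (fun k => φ k x) = 0} := isClosed_eq hc continuous_const
  exact (hcl.closure_subset_iff.2 hS) hp

lemma secantVariety_mono (c : InnerProductSpace.Core ℂ E) (X : Set (ℙ ℂ E)) :
    Monotone (secantVariety c X) :=
  fun _ _ h => euclClosure_mono c (secantPoints_mono X h)

lemma genericRank_le [FiniteDimensional ℂ E] (c : InnerProductSpace.Core ℂ E) {X : Set (ℙ ℂ E)}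
    {r : ℕ} (h : (linSpan X : Set E) ⊆ secantPoints X r) : genericRank c X ≤ r := by
  refine iInf₂_le r (Set.Subset.antisymm ?_ ?_)
  · exact euclClosure_submodule c _ (secantPoints_subset_linSpan X r)
  · exact h.trans (subset_euclClosure c _)

/-- If the points of the cone are pairwise proportional, then the cone is a line or `0`, and the
generic rank is at most `1`. -/
lemma genericRank_le_one_of_line [FiniteDimensional ℂ E] (c : InnerProductSpace.Core ℂ E)
    {ι : Type*} (f : ι → E) (e : E) (he : ∀ a, ∃ z : ℂ, f a = z • e) :
    genericRank c (projImage f) ≤ 1 := by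
  refine mod_cast genericRank_le c (r := 1) fun p hp => ?_
  rw [mem_secantPoints_one]
  by_cases h0 : ∀ a, f a = 0
  · have : linSpan (projImage f) ≤ ⊥ := by
      refine Submodule.span_le.2 fun x hx => ?_
      rcases mem_affineCone_projImage.1 hx with rfl | ⟨a, z, rfl⟩
      · simp
      · simp [h0]
    rw [(Submodule.mem_bot ℂ).1 (this hp)]
    exact zero_mem_affineCone _
  · push Not at h0
    obtain ⟨a, ha⟩ := h0
    obtain ⟨z, hz⟩ := he a
    have hz0 : z ≠ 0 := by
      rintro rfl
      exact ha (by simpa using hz)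
    have : linSpan (projImage f) ≤ Submodule.span ℂ {f a} := by
      refine Submodule.span_le.2 fun x hx => ?_
      rcases mem_affineCone_projImage.1 hx with rfl | ⟨b, y, rfl⟩
      · simp
      · obtain ⟨t, ht⟩ := he b
        refine Submodule.mem_span_singleton.2 ⟨y * t * z⁻¹, ?_⟩
        rw [ht, hz, smul_smul, smul_smul, mul_assoc, inv_mul_cancel₀ hz0, mul_one]
    obtain ⟨t, rfl⟩ := Submodule.mem_span_singleton.1 (this hp)
    exact smul_mem_affineCone f t a

/-- A point of the second secant variety that has neither border rank `1` nor rank `2` witnesses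
the failure of best approximation: the distance from it to the tensors of rank at most `2` is `0`,
and is not attained. -/
lemma bestApproxFails_of [FiniteDimensional ℂ E] (c : InnerProductSpace.Core ℂ E)
    {X : Set (ℙ ℂ E)} (hg : 2 < genericRank c X) {A : E} (h2 : A ∈ secantVariety c X 2)
    (h1 : A ∉ secantVariety c X 1) (hA : A ∉ secantPoints X 2) : BestApproxFails c X := by
  have hspan : A ∈ linSpan X :=
    euclClosure_submodule c _ (secantPoints_subset_linSpan X 2) h2
  refine ⟨A, hspan, 2, rfl, by exact_mod_cast hg, ?_, ?_, ?_⟩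
  · refine le_antisymm (iInf₂_le 2 h2) (le_iInf₂ fun r hr => ?_)
    have : 2 ≤ r := by
      by_contra hlt
      exact h1 (secantVariety_mono c X (by omega : r ≤ 1) hr)
    exact_mod_cast this
  · by_contra hle
    exact hA (mem_secantPoints_of_xrank_le (not_lt.1 hle))
  · rintro ⟨B, ⟨hB, hBr⟩, hmin⟩
    have hB2 := mem_secantPoints_of_xrank_le hBr
    let : NormedAddCommGroup E := c.toNormedAddCommGroup
    have hnorm_eq : ∀ x : E, hnorm c x = ‖x‖ := fun x => rfl
    have hle : ∀ ε > 0, ‖A - B‖ ≤ ε := by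
      intro ε hε
      obtain ⟨q, hq, hlt⟩ := h2 ε hε
      have hmem : q ∈ rankAtMost X 2 :=
        ⟨secantPoints_subset_linSpan X 2 hq, xrank_le_of_mem hq⟩
      have := hmin hmem
      simp only [Set.mem_ofPred_eq] at this
      rw [← hnorm_eq]
      exact this.trans hlt.le
    have h0 : ‖A - B‖ = 0 := le_antisymm (le_of_forall_pos_le_add (by simpa using hle))
      (norm_nonneg _)
    rw [norm_eq_zero, sub_eq_zero] at h0
    exact hA (h0 ▸ hB2)

end Closure

/-! ### Tangent vectors of curves -/

section WeakDeriv

variable {E : Type*} [AddCommGroup E] [Module ℂ E]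

/-- `b` is the derivative at `0` of the curve `f`, tested on all linear functionals. In finite
dimension this is the usual derivative, but no norm has to be chosen. -/
def HasWeakDeriv (f : ℂ → E) (b : E) : Prop :=
  ∀ φ : Module.Dual ℂ E, HasDerivAt (fun t => φ (f t)) (φ b) 0

lemma hasWeakDeriv_line (a b : E) : HasWeakDeriv (fun t : ℂ => a + t • b) b := by
  intro φ
  simp only [map_add, map_smul, smul_eq_mul]
  simpa using ((hasDerivAt_id (0 : ℂ)).mul_const (φ b)).const_add (φ a)

/-- The product rule for a multilinear map. -/
lemma HasWeakDeriv.multilinear {ι : Type*} [Fintype ι] [DecidableEq ι] {F : ι → Type*}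
    [∀ i, AddCommGroup (F i)] [∀ i, Module ℂ (F i)] [∀ i, FiniteDimensional ℂ (F i)]
    (g : MultilinearMap ℂ F E) {f : ∀ i, ℂ → F i} {b : ∀ i, F i}
    (h : ∀ i, HasWeakDeriv (f i) (b i)) :
    HasWeakDeriv (fun t => g fun i => f i t)
      (∑ i, g (Function.update (fun j => f j 0) i (b i))) := by
  intro φ
  set M : MultilinearMap ℂ F ℂ := φ.compMultilinearMap g
  let B := fun i => Module.finBasis ℂ (F i)
  have key : ∀ v : ∀ i, F i,
      φ (g v) = ∑ κ : ∀ i, Fin (Module.finrank ℂ (F i)),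
        (∏ i, (B i).coord (κ i) (v i)) * M (fun i => B i (κ i)) := by
    intro v
    have hv : v = fun i => ∑ k, (B i).coord k (v i) • B i k :=
      funext fun i => ((B i).sum_repr (v i)).symm
    calc φ (g v) = M (fun i => ∑ k, (B i).coord k (v i) • B i k) := congrArg M hv
      _ = _ := M.map_sum _
      _ = _ := ?_
    refine Finset.sum_congr rfl fun κ _ => ?_
    rw [M.map_smul_univ, smul_eq_mul]
  rw [show (fun t => φ (g fun i => f i t)) = _ from funext fun t => key fun i => f i t, map_sum,
    Finset.sum_congr rfl fun i _ => key (Function.update (fun j => f j 0) i (b i)),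
    Finset.sum_comm]
  refine HasDerivAt.fun_sum fun κ _ => ?_
  rw [← Finset.sum_mul]
  refine HasDerivAt.mul_const ?_ _
  have h3 := HasDerivAt.fun_finsetProd (u := Finset.univ) (x := (0 : ℂ))
    (f := fun i t => (B i).coord (κ i) (f i t)) (f' := fun i => (B i).coord (κ i) (b i))
    fun i _ => h i ((B i).coord (κ i))
  refine h3.congr_deriv (Finset.sum_congr rfl fun i _ => ?_)
  rw [smul_eq_mul, ← Finset.prod_erase_mul Finset.univ _ (Finset.mem_univ i)]
  congr 1
  · refine Finset.prod_congr rfl fun j hj => ?_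
    rw [Function.update_of_ne (Finset.ne_of_mem_erase hj)]
  · rw [Function.update_self]

/-- A tangent vector of a curve in the cone is a limit of sums of two points of the cone, namely
of the difference quotients. -/
lemma HasWeakDeriv.mem_secantVariety [FiniteDimensional ℂ E] (c : InnerProductSpace.Core ℂ E)
    {ι : Type*} {F : ι → E} {g : ℂ → ι} {A : E} (h : HasWeakDeriv (fun t => F (g t)) A) :
    A ∈ secantVariety c (projImage F) 2 := by
  rw [secantVariety, mem_euclClosure_iff]
  let : NormedAddCommGroup E := c.toNormedAddCommGroup
  let : InnerProductSpace ℂ E := InnerProductSpace.ofCore c.toCore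
  have hd : HasDerivAt (fun t => F (g t)) A 0 := by
    let e := (Module.finBasis ℂ E).equivFunL
    have h1 : HasDerivAt (fun t => e (F (g t))) (e A) 0 := by
      rw [hasDerivAt_pi]
      intro i
      exact h ((Module.finBasis ℂ E).coord i)
    have h2 := (e.symm : _ →L[ℂ] E).hasFDerivAt.comp_hasDerivAt (0 : ℂ) h1
    simpa [Function.comp_def] using h2
  rw [hasDerivAt_iff_tendsto_slope] at hd
  refine mem_closure_of_tendsto hd (Eventually.of_forall fun t => ?_)
  rw [mem_secantPoints_two]
  refine ⟨t⁻¹ • F (g t), smul_mem_affineCone F _ _, (-t⁻¹) • F (g 0), smul_mem_affineCone F _ _, ?_⟩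
  simp [slope_def_module, sub_eq_add_neg]

end WeakDeriv

/-! ### Product functionals on tensor products -/

section Evaluation

variable {ι : Type*} [Fintype ι] {F : ι → Type*} [∀ i, AddCommGroup (F i)] [∀ i, Module ℂ (F i)]

/-- The functional `η₁ ⊗ ⋯ ⊗ η_m` on a tensor product. -/
def evalProd (η : ∀ i, Module.Dual ℂ (F i)) : Module.Dual ℂ (⨂[ℂ] i, F i) :=
  PiTensorProduct.lift ((MultilinearMap.mkPiAlgebra ℂ ι ℂ).compLinearMap η)

@[simp] lemma evalProd_tprod (η : ∀ i, Module.Dual ℂ (F i)) (v : ∀ i, F i) :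
    evalProd η (PiTensorProduct.tprod ℂ v) = ∏ i, η i (v i) := by
  simp [evalProd]

end Evaluation

/-! ### Tensors of Segre type -/

section Segre

/-- A curve together with its tangent vector at `0`, where the point and the tangent vector are
linearly independent; the latter is expressed by a pair of dual functionals. -/
structure IsTangentPair {E : Type*} [AddCommGroup E] [Module ℂ E] (f : ℂ → E) (b : E) : Prop where
  hasWeakDeriv : HasWeakDeriv f b
  exists_dual : ∃ α β : Module.Dual ℂ E, α (f 0) = 1 ∧ α b = 0 ∧ β (f 0) = 0 ∧ β b = 1

/-- The tensor `W = e₁⊗e₀⊗e₀ + e₀⊗e₁⊗e₀ + e₀⊗e₀⊗e₁` of format `2 × 2 × 2`, given by its entries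
`W i j k`, is not a sum of two tensors of rank one. Its slices in the first direction span a pencil
of `2 × 2` matrices whose determinant has a double zero, whereas for a sum of two rank-one tensors
the determinant of the pencil is a product of two linear forms that would have to agree. -/
lemma w_tensor_not_rank_two {p₀ p₁ q₀ q₁ r₀ r₁ p₀' p₁' q₀' q₁' r₀' r₁' : ℂ}
    (h000 : p₀ * q₀ * r₀ + p₀' * q₀' * r₀' = 0) (h100 : p₁ * q₀ * r₀ + p₁' * q₀' * r₀' = 1)
    (h010 : p₀ * q₁ * r₀ + p₀' * q₁' * r₀' = 1) (h001 : p₀ * q₀ * r₁ + p₀' * q₀' * r₁' = 1)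
    (h110 : p₁ * q₁ * r₀ + p₁' * q₁' * r₀' = 0) (h101 : p₁ * q₀ * r₁ + p₁' * q₀' * r₁' = 0)
    (h011 : p₀ * q₁ * r₁ + p₀' * q₁' * r₁' = 0) (h111 : p₁ * q₁ * r₁ + p₁' * q₁' * r₁' = 0) :
    False := by
  set D := (q₀ * q₁' - q₁ * q₀') * (r₀ * r₁' - r₁ * r₀') with hD
  have e0 : p₀ * p₀' * D = -1 := by
    have : p₀ * p₀' * D = (p₀ * q₀ * r₀ + p₀' * q₀' * r₀') * (p₀ * q₁ * r₁ + p₀' * q₁' * r₁') -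
        (p₀ * q₀ * r₁ + p₀' * q₀' * r₁') * (p₀ * q₁ * r₀ + p₀' * q₁' * r₀') := by
      rw [hD]; ring
    rw [this, h000, h001, h010]; ring
  have e1 : p₁ * p₁' * D = 0 := by
    have : p₁ * p₁' * D = (p₁ * q₀ * r₀ + p₁' * q₀' * r₀') * (p₁ * q₁ * r₁ + p₁' * q₁' * r₁') -
        (p₁ * q₀ * r₁ + p₁' * q₀' * r₁') * (p₁ * q₁ * r₀ + p₁' * q₁' * r₀') := by
      rw [hD]; ring
    rw [this, h111, h101]; ring
  have e2 : (p₀ * p₁' + p₁ * p₀') * D = 0 := by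
    have : (p₀ * p₁' + p₁ * p₀') * D =
        (p₀ * q₀ * r₀ + p₀' * q₀' * r₀') * (p₁ * q₁ * r₁ + p₁' * q₁' * r₁') +
        (p₁ * q₀ * r₀ + p₁' * q₀' * r₀') * (p₀ * q₁ * r₁ + p₀' * q₁' * r₁') -
        (p₀ * q₀ * r₁ + p₀' * q₀' * r₁') * (p₁ * q₁ * r₀ + p₁' * q₁' * r₀') -
        (p₁ * q₀ * r₁ + p₁' * q₀' * r₁') * (p₀ * q₁ * r₀ + p₀' * q₁' * r₀') := by
      rw [hD]; ring
    rw [this, h111, h011, h110, h101]; ring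
  have hne : p₀ * p₀' * D ≠ 0 := by rw [e0]; norm_num
  have hD0 : D ≠ 0 := right_ne_zero_of_mul hne
  have hp0 : p₀ ≠ 0 := left_ne_zero_of_mul (left_ne_zero_of_mul hne)
  have hp0' : p₀' ≠ 0 := right_ne_zero_of_mul (left_ne_zero_of_mul hne)
  have e2' := (mul_eq_zero.1 e2).resolve_right hD0
  rcases mul_eq_zero.1 ((mul_eq_zero.1 e1).resolve_right hD0) with h | h
  · simp [h, hp0] at e2'
    simp [h, e2'] at h100
  · simp [h, hp0'] at e2'
    simp [h, e2'] at h100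

variable {m : ℕ} {F : Fin m → Type*} [∀ i, AddCommGroup (F i)] [∀ i, Module ℂ (F i)]

/-- The functional that applies `β i` in the positions `i ∈ S` and `α i` in all others. -/
def evalMix (α β : ∀ i, Module.Dual ℂ (F i)) (S : Finset (Fin m)) :
    Module.Dual ℂ (⨂[ℂ] i, F i) :=
  evalProd fun i => if i ∈ S then β i else α i

lemma evalMix_tangent (α β : ∀ i, Module.Dual ℂ (F i)) {a b : ∀ i, F i}
    (h : ∀ i, α i (a i) = 1 ∧ α i (b i) = 0 ∧ β i (a i) = 0 ∧ β i (b i) = 1)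
    (S : Finset (Fin m)) :
    evalMix α β S (∑ i, PiTensorProduct.tprod ℂ (Function.update a i (b i))) =
      ∑ i, if S = {i} then 1 else 0 := by
  rw [map_sum]
  refine Finset.sum_congr rfl fun i _ => ?_
  rw [evalMix, evalProd_tprod]
  have hfac : ∀ j, (if j ∈ S then β j else α j) (Function.update a i (b i) j) =
      if (j ∈ S ↔ j = i) then 1 else 0 := by
    intro j
    obtain ⟨h1, h2, h3, h4⟩ := h j
    by_cases hj : j = i
    · subst hj
      by_cases hS : j ∈ S <;> simp [hS, h2, h4]
    · by_cases hS : j ∈ S <;> simp [hS, hj, h1, h3]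
  simp_rw [hfac]
  rw [Finset.prod_ite_zero]
  simp [Finset.ext_iff]

lemma evalMix_tprod (α β : ∀ i, Module.Dual ℂ (F i)) {i₀ i₁ i₂ : Fin m} (h01 : i₀ ≠ i₁)
    (h02 : i₀ ≠ i₂) (h12 : i₁ ≠ i₂) (v : ∀ i, F i) :
    ∃ ρ : ℂ, ∀ S ⊆ ({i₀, i₁, i₂} : Finset (Fin m)), evalMix α β S (PiTensorProduct.tprod ℂ v) =
      (if i₀ ∈ S then β i₀ else α i₀) (v i₀) * (if i₁ ∈ S then β i₁ else α i₁) (v i₁) *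
      ((if i₂ ∈ S then β i₂ else α i₂) (v i₂) * ρ) := by
  refine ⟨∏ j ∈ ({i₀, i₁, i₂} : Finset (Fin m))ᶜ, α j (v j), fun S hS => ?_⟩
  rw [evalMix, evalProd_tprod, ← Finset.prod_mul_prod_compl ({i₀, i₁, i₂} : Finset (Fin m)),
    Finset.prod_insert (by simp [h01, h02]), Finset.prod_insert (by simp [h12]),
    Finset.prod_singleton, ← mul_assoc, mul_assoc _ _ (∏ j ∈ _, _), ← mul_assoc,
    mul_assoc _ _ (∏ j ∈ _, _)]
  congr 2
  refine Finset.prod_congr rfl fun j hj => ?_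
  rw [if_neg fun hjS => (Finset.mem_compl.1 hj) (hS hjS)]

/-- A variety `X` of decomposable tensors with at least three factors, together with a curve
`t ↦ f₁(t) ⊗ ⋯ ⊗ f_m(t)` on its cone for which each `f_i(0)` and `f_i'(0)` are independent: its
tangent vector at `0` is a limit of sums of two points, but is not such a sum, since dual
functionals map it to the `W` tensor. -/
theorem bestApproxFails_of_segre (hm : 3 ≤ m) [∀ i, FiniteDimensional ℂ (F i)]
    (c : InnerProductSpace.Core ℂ (⨂[ℂ] i, F i)) {κ : Type*} {G : κ → ⨂[ℂ] i, F i}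
    (hG : ∀ a, ∃ v, G a = PiTensorProduct.tprod ℂ v) {g : ℂ → κ} {f : ∀ i, ℂ → F i} {b : ∀ i, F i}
    (hgf : ∀ t, G (g t) = PiTensorProduct.tprod ℂ fun i => f i t)
    (hf : ∀ i, IsTangentPair (f i) (b i))
    (hg : 2 < genericRank c (projImage G)) : BestApproxFails c (projImage G) := by
  choose α β hαβ using fun i => (hf i).exists_dual
  set A := ∑ i, PiTensorProduct.tprod ℂ (Function.update (fun j => f j 0) i (b i)) with hA
  have hcone : ∀ x ∈ affineCone (projImage G), ∃ v, x = PiTensorProduct.tprod ℂ v := by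
    intro x hx
    have i₀ : Fin m := ⟨0, by omega⟩
    rcases mem_affineCone_projImage.1 hx with rfl | ⟨a, z, rfl⟩
    · exact ⟨fun _ => 0, (MultilinearMap.map_coord_zero _ i₀ rfl).symm⟩
    · obtain ⟨v, hv⟩ := hG a
      refine ⟨Function.update v i₀ (z • v i₀), ?_⟩
      rw [MultilinearMap.map_update_smul, Function.update_eq_self, hv]
  obtain ⟨i₀, i₁, i₂, h01, h02, h12⟩ : ∃ i₀ i₁ i₂ : Fin m, i₀ ≠ i₁ ∧ i₀ ≠ i₂ ∧ i₁ ≠ i₂ :=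
    ⟨⟨0, by omega⟩, ⟨1, by omega⟩, ⟨2, by omega⟩, by simp, by simp, by simp⟩
  have hval := evalMix_tangent α β hαβ
  have hval0 : ∀ S : Finset (Fin m), S.card ≠ 1 → evalMix α β S A = 0 := by
    intro S hS
    rw [hA, hval]
    refine Finset.sum_eq_zero fun i _ => if_neg ?_
    rintro rfl
    simp at hS
  have hval1 : ∀ i, evalMix α β {i} A = 1 := by
    intro i
    rw [hA, hval]
    simp [Finset.singleton_inj]
  have c01 : ({i₀, i₁} : Finset (Fin m)).card ≠ 1 := by simp [h01]
  have c02 : ({i₀, i₂} : Finset (Fin m)).card ≠ 1 := by simp [h02]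
  have c12 : ({i₁, i₂} : Finset (Fin m)).card ≠ 1 := by simp [h12]
  have c012 : ({i₀, i₁, i₂} : Finset (Fin m)).card ≠ 1 := by
    rw [Finset.card_insert_of_notMem (by simp [h01, h02])]; simp [h12]
  refine bestApproxFails_of c hg (A := A) ?_ ?_ ?_
  · have := HasWeakDeriv.multilinear (PiTensorProduct.tprod ℂ) fun i => (hf i).hasWeakDeriv
    exact HasWeakDeriv.mem_secantVariety c (F := G) (g := g) (by simpa [hgf] using this)
  · intro h
    have := eq_zero_of_mem_euclClosure c (evalMix α β)
      (fun z => z {i₀} * z {i₁} - z ∅ * z {i₀, i₁}) (by fun_prop) (fun x hx => ?_) h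
    · simp [hval1, hval0, c01] at this
    · obtain ⟨v, rfl⟩ := hcone x (mem_secantPoints_one.1 hx)
      obtain ⟨ρ, hρ⟩ := evalMix_tprod α β h01 h02 h12 v
      simp only
      rw [hρ _ (by simp), hρ _ (by simp), hρ _ (by simp), hρ _ (by grind)]
      simp [h01, h01.symm, h02.symm, h12.symm]
      ring
  · rw [mem_secantPoints_two]
    rintro ⟨x, hx, y, hy, hxy⟩
    obtain ⟨v, rfl⟩ := hcone x hx
    obtain ⟨w, rfl⟩ := hcone y hy
    obtain ⟨ρ, hρ⟩ := evalMix_tprod α β h01 h02 h12 v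
    obtain ⟨σ, hσ⟩ := evalMix_tprod α β h01 h02 h12 w
    have key : ∀ S ⊆ ({i₀, i₁, i₂} : Finset (Fin m)), evalMix α β S A = _ := fun S hS => by
      rw [hxy, map_add, hρ S hS, hσ S hS]
    have k0 := key ∅ (by simp)
    have k1 := key {i₀} (by simp)
    have k2 := key {i₁} (by simp)
    have k3 := key {i₂} (by simp)
    have k4 := key {i₀, i₁} (by grind)
    have k5 := key {i₀, i₂} (by grind)
    have k6 := key {i₁, i₂} (by grind)
    have k7 := key {i₀, i₁, i₂} (by grind)
    rw [hval0 _ (by simp)] at k0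
    rw [hval1] at k1 k2 k3
    rw [hval0 _ c01] at k4
    rw [hval0 _ c02] at k5
    rw [hval0 _ c12] at k6
    rw [hval0 _ c012] at k7
    simp only [Finset.notMem_empty, Finset.mem_singleton, Finset.mem_insert, h01, h02, h12,
      h01.symm, h02.symm, h12.symm, if_true, if_false, or_false, or_true] at k0 k1 k2 k3 k4 k5 k6 k7
    exact w_tensor_not_rank_two k0.symm k1.symm k2.symm k3.symm k4.symm k5.symm k6.symm k7.symm

end Segre

/-! ### Symmetric and alternating products, and curves in the cones -/

section Curves

variable {V : Type*} [AddCommGroup V] [Module ℂ V]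

/-- The symmetric product as a multilinear map. -/
def symProdMap (V : Type*) [AddCommGroup V] [Module ℂ V] (d : ℕ) :
    MultilinearMap ℂ (fun _ : Fin d => V) (⨂[ℂ] _ : Fin d, V) :=
  ((d.factorial : ℂ)⁻¹) • ∑ τ : Equiv.Perm (Fin d), (PiTensorProduct.tprod ℂ).domDomCongr τ

lemma symProdMap_apply {d : ℕ} (v : Fin d → V) : symProdMap V d v = symProd v := by
  simp [symProdMap, symProd]

/-- The alternating product as an alternating map. -/
def altProdMap (V : Type*) [AddCommGroup V] [Module ℂ V] (d : ℕ) :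
    V [⋀^Fin d]→ₗ[ℂ] (⨂[ℂ] _ : Fin d, V) :=
  ((d.factorial : ℂ)⁻¹) • MultilinearMap.alternatization (PiTensorProduct.tprod ℂ)

lemma altProdMap_apply {d : ℕ} (v : Fin d → V) : altProdMap V d v = altProd v := by
  simp only [altProdMap, AlternatingMap.smul_apply, MultilinearMap.alternatization_apply, altProd,
    MultilinearMap.domDomCongr_apply]
  rfl

lemma evalProd_symProd {d : ℕ} (η : Fin d → Module.Dual ℂ V) (v : Fin d → V) :
    evalProd η (symProd v) =
      ((d.factorial : ℂ)⁻¹) * ∑ τ : Equiv.Perm (Fin d), ∏ i, η i (v (τ i)) := by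
  simp [symProd]

lemma evalProd_symProd_const {d : ℕ} (ξ : Module.Dual ℂ V) (v : Fin d → V) :
    evalProd (fun _ => ξ) (symProd v) = ∏ i, ξ (v i) := by
  rw [evalProd_symProd]
  have : ∀ τ : Equiv.Perm (Fin d), ∏ i, ξ (v (τ i)) = ∏ i, ξ (v i) :=
    fun τ => Equiv.prod_comp τ fun i => ξ (v i)
  simp [this, Fintype.card_perm, Nat.factorial_ne_zero]

lemma evalProd_altProd {d : ℕ} (η : Fin d → Module.Dual ℂ V) (v : Fin d → V) :
    evalProd η (altProd v) =
      ((d.factorial : ℂ)⁻¹) * (Matrix.of fun i j => η i (v j)).det := by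
  rw [← Matrix.det_transpose, Matrix.det_apply]
  simp [altProd, Units.smul_def]

lemma exists_dual_of_linearIndependent {ι : Type*} {e : ι → V} (he : LinearIndependent ℂ e)
    [DecidableEq ι] : ∃ δ : ι → Module.Dual ℂ V, ∀ i j, δ i (e j) = if i = j then 1 else 0 := by
  have := fun i : ι => LinearMap.exists_extend ((Module.Basis.span he).coord i)
  choose δ hδ using this
  refine ⟨δ, fun i j => ?_⟩
  have hj : e j = (Module.Basis.span he j : V) := by rw [Module.Basis.span_apply]
  have h1 := LinearMap.congr_fun (hδ i) (Module.Basis.span he j)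
  simp only [LinearMap.comp_apply, Submodule.subtype_apply] at h1
  rw [hj, h1, Module.Basis.coord_apply, Module.Basis.repr_self, Finsupp.single_apply]
  simp [eq_comm]

lemma exists_linearIndependent_fin [FiniteDimensional ℂ V] {n : ℕ} (h : n ≤ Module.finrank ℂ V) :
    ∃ (e : Fin n → V) (δ : Fin n → Module.Dual ℂ V), ∀ i j, δ i (e j) = if i = j then 1 else 0 := by
  have hli := (Module.finBasis ℂ V).linearIndependent.comp (Fin.castLE h) (Fin.castLE_injective h)
  exact ⟨_, exists_dual_of_linearIndependent hli⟩

lemma IsTangentPair.line {a b : V} (α β : Module.Dual ℂ V) (h1 : α a = 1) (h2 : α b = 0)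
    (h3 : β a = 0) (h4 : β b ≠ 0) : IsTangentPair (fun t : ℂ => a + t • b) b := by
  refine ⟨hasWeakDeriv_line a b, α, (β b)⁻¹ • β, ?_, h2, ?_, ?_⟩ <;> simp [h1, h3, h4]

lemma exists_isTangentPair [FiniteDimensional ℂ V] (h : 2 ≤ Module.finrank ℂ V) :
    ∃ (f : ℂ → V) (b : V), IsTangentPair f b := by
  obtain ⟨e, δ, hδ⟩ := exists_linearIndependent_fin h
  exact ⟨_, _, IsTangentPair.line (a := e 0) (b := e 1) (δ 0) (δ 1) (by simp [hδ]) (by simp [hδ])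
    (by simp [hδ]) (by simp [hδ])⟩

/-- In the cone over the Chow variety: the line `(e₀ + t e₁) ∘ e₀ ∘ ⋯ ∘ e₀`. -/
lemma exists_isTangentPair_symProd [FiniteDimensional ℂ V] (h : 2 ≤ Module.finrank ℂ V) {d : ℕ}
    (hd : 1 ≤ d) : ∃ (v : ℂ → Fin d → V) (b : _), IsTangentPair (fun t => symProd (v t)) b := by
  obtain ⟨e, δ, hδ⟩ := exists_linearIndependent_fin h
  obtain ⟨n, rfl⟩ : ∃ n, d = n + 1 := ⟨d - 1, by omega⟩
  let u : Fin (n + 1) → V := fun _ => e 0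
  have hline : ∀ t : ℂ, symProd (Function.update u 0 (e 0 + t • e 1)) =
      symProd u + t • symProd (Function.update u 0 (e 1)) := by
    intro t
    simp only [← symProdMap_apply]
    rw [MultilinearMap.map_update_add, MultilinearMap.map_update_smul]
    congr 2
    exact Function.update_eq_self 0 u
  refine ⟨fun t => Function.update u 0 (e 0 + t • e 1), symProd (Function.update u 0 (e 1)), ?_⟩
  simp_rw [hline]
  refine IsTangentPair.line (evalProd fun _ => δ 0) (evalProd (Fin.cons (δ 1) fun _ => δ 0))
    ?_ ?_ ?_ ?_
  · rw [evalProd_symProd_const]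
    simp [u, hδ]
  · rw [evalProd_symProd_const, Fin.prod_univ_succ]
    simp [hδ]
  · rw [evalProd_symProd]
    simp [u, hδ, Fin.prod_univ_succ]
  · rw [evalProd_symProd]
    have hterm : ∀ τ : Equiv.Perm (Fin (n + 1)),
        ∏ i, (Fin.cons (δ 1) (fun _ => δ 0) : Fin (n + 1) → Module.Dual ℂ V) i
          (Function.update u 0 (e 1) (τ i)) = if τ 0 = 0 then 1 else 0 := by
      intro τ
      rw [Fin.prod_univ_succ]
      split_ifs with h0
      · have : ∀ i : Fin n, τ i.succ ≠ 0 := fun i hi =>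
          Fin.succ_ne_zero i (τ.injective (hi.trans h0.symm))
        simp [h0, hδ, u, this, Function.update_of_ne]
      · simp [h0, hδ, u, Function.update_of_ne]
    rw [Finset.sum_congr rfl fun τ _ => hterm τ, Finset.sum_boole]
    refine mul_ne_zero (inv_ne_zero (Nat.cast_ne_zero.2 (Nat.factorial_ne_zero _)))
      (Nat.cast_ne_zero.2 (Finset.card_ne_zero.2 ⟨1, by simp⟩))

/-- In the cone over the Grassmann variety: the line `(e₁ + t e₀) ∧ e₂ ∧ ⋯ ∧ e_k`. -/
lemma exists_isTangentPair_altProd [FiniteDimensional ℂ V] {k : ℕ} (hk : 1 ≤ k)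
    (h : k < Module.finrank ℂ V) :
    ∃ (v : ℂ → Fin k → V) (b : _), IsTangentPair (fun t => altProd (v t)) b := by
  obtain ⟨e, δ, hδ⟩ := exists_linearIndependent_fin (n := k + 1) h
  obtain ⟨n, rfl⟩ : ∃ n, k = n + 1 := ⟨k - 1, by omega⟩
  let u : Fin (n + 1) → V := fun i => e i.succ
  let η : Fin (n + 1) → Module.Dual ℂ V := fun i => δ i.succ
  have hline : ∀ t : ℂ, altProd (Function.update u 0 (u 0 + t • e 0)) =
      altProd u + t • altProd (Function.update u 0 (e 0)) := by
    intro t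
    simp only [← altProdMap_apply]
    rw [AlternatingMap.map_update_add, AlternatingMap.map_update_smul, Function.update_eq_self]
  refine ⟨fun t => Function.update u 0 (u 0 + t • e 0), altProd (Function.update u 0 (e 0)), ?_⟩
  simp_rw [hline]
  have hf : ((n + 1).factorial : ℂ) ≠ 0 := Nat.cast_ne_zero.2 (Nat.factorial_ne_zero _)
  refine IsTangentPair.line (((n + 1).factorial : ℂ) • evalProd η)
    (evalProd (Function.update η 0 (δ 0))) ?_ ?_ ?_ ?_
  · have : (Matrix.of fun i j => η i (u j)) = 1 := by
      ext i j; simp [η, u, hδ, Matrix.one_apply]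
    rw [LinearMap.smul_apply, evalProd_altProd, this]
    simp [hf]
  · rw [LinearMap.smul_apply, evalProd_altProd, Matrix.det_eq_zero_of_column_eq_zero 0]
    · simp
    · intro i; simp [η, hδ]
  · rw [evalProd_altProd, Matrix.det_eq_zero_of_row_eq_zero 0]
    · simp
    · intro j
      simp [u, hδ, (Fin.succ_ne_zero j).symm]
  · have : (Matrix.of fun i j =>
        Function.update η 0 (δ 0) i (Function.update u 0 (e 0) j)) = 1 := by
      ext i j
      refine Fin.cases ?_ (fun i => ?_) i <;> refine Fin.cases ?_ (fun j => ?_) j <;>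
        simp [η, u, hδ, Matrix.one_apply, Fin.succ_ne_zero, (Fin.succ_ne_zero _).symm]
    rw [evalProd_altProd, this]
    simp [hf]

/-- Tensor powers of a curve: if `α, β` are dual to the point and the tangent vector, then
`α ⊗ ⋯ ⊗ α` and `β ⊗ α ⊗ ⋯ ⊗ α` are dual to those of the power. -/
lemma IsTangentPair.tpow [FiniteDimensional ℂ V] {f : ℂ → V} {b : V} (h : IsTangentPair f b)
    {k : ℕ} (hk : 1 ≤ k) : ∃ b', IsTangentPair (fun t => tpow k (f t)) b' := by
  obtain ⟨n, rfl⟩ : ∃ n, k = n + 1 := ⟨k - 1, by omega⟩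
  obtain ⟨hd, α, β, h1, h2, h3, h4⟩ := h
  refine ⟨_, HasWeakDeriv.multilinear (PiTensorProduct.tprod ℂ) (f := fun _ => f)
    (b := fun _ => b) fun _ => hd,
    evalProd fun _ => α, evalProd (Fin.cons β fun _ => α), ?_, ?_, ?_, ?_⟩
  · simp [XRank.tpow, h1]
  · rw [map_sum]
    refine Finset.sum_eq_zero fun i _ => ?_
    rw [evalProd_tprod]
    exact Finset.prod_eq_zero (Finset.mem_univ i) (by simp [h2])
  · simp [XRank.tpow, Fin.prod_univ_succ, h3]
  · rw [map_sum, Fin.sum_univ_succ, Finset.sum_eq_zero]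
    · simp [Fin.prod_univ_succ, h1, h4]
    · intro i _
      rw [evalProd_tprod]
      refine Finset.prod_eq_zero (Finset.mem_univ 0) ?_
      rw [Function.update_of_ne (Fin.succ_ne_zero i).symm]
      simp [h3]

end Curves

/-! ### The Segre families -/

section SegreCases

variable {m : ℕ} {V : Fin m → Type*} [∀ i, AddCommGroup (V i)] [∀ i, Module ℂ (V i)]
  [∀ i, FiniteDimensional ℂ (V i)]

lemma bestApproxFails_segre (c : InnerProductSpace.Core ℂ (⨂[ℂ] i, V i)) (hm : 3 ≤ m)
    (hV : ∀ i, 2 ≤ Module.finrank ℂ (V i)) (hg : 2 < genericRank c (segre V)) :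
    BestApproxFails c (segre V) := by
  choose f b hfb using fun i => exists_isTangentPair (hV i)
  exact bestApproxFails_of_segre hm c (g := fun t i => f i t) (fun a => ⟨a, rfl⟩) (fun _ => rfl)
    hfb hg

lemma bestApproxFails_segreVeronese {d : Fin m → ℕ}
    (c : InnerProductSpace.Core ℂ (⨂[ℂ] i, ⨂[ℂ] _ : Fin (d i), V i)) (hm : 3 ≤ m)
    (hd : ∀ i, 1 ≤ d i) (hV : ∀ i, 2 ≤ Module.finrank ℂ (V i))
    (hg : 2 < genericRank c (segreVeronese V d)) : BestApproxFails c (segreVeronese V d) := by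
  choose f b hfb using fun i => exists_isTangentPair (hV i)
  choose b' hb' using fun i => (hfb i).tpow (hd i)
  exact bestApproxFails_of_segre hm c (g := fun t i => f i t) (fun a => ⟨_, rfl⟩) (fun _ => rfl)
    hb' hg

lemma bestApproxFails_segreChow {d : Fin m → ℕ}
    (c : InnerProductSpace.Core ℂ (⨂[ℂ] i, ⨂[ℂ] _ : Fin (d i), V i)) (hm : 3 ≤ m)
    (hd : ∀ i, 1 ≤ d i) (hV : ∀ i, 2 ≤ Module.finrank ℂ (V i))
    (hg : 2 < genericRank c (segreChow V d)) : BestApproxFails c (segreChow V d) := by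
  choose v b hvb using fun i => exists_isTangentPair_symProd (hV i) (hd i)
  exact bestApproxFails_of_segre hm c (g := fun t i => v i t) (fun a => ⟨_, rfl⟩) (fun _ => rfl)
    hvb hg

lemma bestApproxFails_segreGrassmann {k : Fin m → ℕ}
    (c : InnerProductSpace.Core ℂ (⨂[ℂ] i, ⨂[ℂ] _ : Fin (k i), V i)) (hm : 3 ≤ m)
    (hk : ∀ i, 1 ≤ k i) (hV : ∀ i, k i < Module.finrank ℂ (V i))
    (hg : 2 < genericRank c (segreGrassmann V k)) : BestApproxFails c (segreGrassmann V k) := by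
  choose v b hvb using fun i => exists_isTangentPair_altProd (hk i) (hV i)
  exact bestApproxFails_of_segre hm c (g := fun t i => v i t) (fun a => ⟨_, rfl⟩) (fun _ => rfl)
    hvb hg

lemma bestApproxFails_segreVeroneseChow {d k : Fin m → ℕ}
    (c : InnerProductSpace.Core ℂ (⨂[ℂ] i, ⨂[ℂ] _ : Fin (k i), ⨂[ℂ] _ : Fin (d i), V i))
    (hm : 3 ≤ m) (hd : ∀ i, 1 ≤ d i) (hk : ∀ i, 1 ≤ k i) (hV : ∀ i, 2 ≤ Module.finrank ℂ (V i))
    (hg : 2 < genericRank c (segreVeroneseChow V d k)) :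
    BestApproxFails c (segreVeroneseChow V d k) := by
  choose v b hvb using fun i => exists_isTangentPair_symProd (hV i) (hd i)
  choose b' hb' using fun i => (hvb i).tpow (hk i)
  exact bestApproxFails_of_segre hm c (g := fun t i => v i t) (fun a => ⟨_, rfl⟩) (fun _ => rfl)
    hb' hg

lemma bestApproxFails_segreVeroneseGrassmann {d k : Fin m → ℕ}
    (c : InnerProductSpace.Core ℂ (⨂[ℂ] i, ⨂[ℂ] _ : Fin (d i), ⨂[ℂ] _ : Fin (k i), V i))
    (hm : 3 ≤ m) (hd : ∀ i, 1 ≤ d i) (hk : ∀ i, 1 ≤ k i) (hV : ∀ i, k i < Module.finrank ℂ (V i))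
    (hg : 2 < genericRank c (segreVeroneseGrassmann V d k)) :
    BestApproxFails c (segreVeroneseGrassmann V d k) := by
  choose v b hvb using fun i => exists_isTangentPair_altProd (hk i) (hV i)
  choose b' hb' using fun i => (hvb i).tpow (hd i)
  exact bestApproxFails_of_segre hm c (g := fun t i => v i t) (fun a => ⟨_, rfl⟩) (fun _ => rfl)
    hb' hg

end SegreCases

/-! ### The Veronese families -/

section VeroneseCases

variable {V : Type*} [AddCommGroup V] [Module ℂ V]

lemma tpow_smul (k : ℕ) (z : ℂ) (v : V) : tpow k (z • v) = z ^ k • tpow k v := by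
  have := (PiTensorProduct.tprod ℂ (s := fun _ : Fin k => V)).map_smul_univ (fun _ => z) fun _ => v
  simpa [tpow] using this

variable [FiniteDimensional ℂ V]

/-- A variety of `k`-th powers lies on the Segre variety of `V ⊗ ⋯ ⊗ V`, and a curve of powers has
all its factors equal. -/
lemma bestApproxFails_of_tpow {k : ℕ} (hk : 3 ≤ k)
    (c : InnerProductSpace.Core ℂ (⨂[ℂ] _ : Fin k, V)) {κ : Type*} (G : κ → V) {g : ℂ → κ} {b : V}
    (h : IsTangentPair (fun t => G (g t)) b)
    (hg : 2 < genericRank c (projImage fun a => tpow k (G a))) :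
    BestApproxFails c (projImage fun a => tpow k (G a)) :=
  bestApproxFails_of_segre hk c (g := g) (fun _ => ⟨_, rfl⟩) (fun _ => rfl) (fun _ => h) hg

lemma not_two_lt_genericRank_tpow {k : ℕ} (c : InnerProductSpace.Core ℂ (⨂[ℂ] _ : Fin k, V))
    {κ : Type*} (G : κ → V) (e : V) (he : ∀ a, ∃ z : ℂ, G a = z • e) :
    ¬ 2 < genericRank c (projImage fun a => tpow k (G a)) := by
  intro h
  have h1 := genericRank_le_one_of_line c (fun a => tpow k (G a)) (tpow k e) fun a => by
    obtain ⟨z, hz⟩ := he a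
    exact ⟨z ^ k, by rw [hz, tpow_smul]⟩
  exact absurd (h.trans_le h1) (by norm_num)

lemma exists_forall_eq_smul (h : Module.finrank ℂ V < 2) :
    ∃ e : V, ∀ v : V, ∃ z : ℂ, v = z • e := by
  obtain ⟨e, he⟩ := finrank_le_one_iff.1 (Nat.lt_succ_iff.1 h)
  exact ⟨e, fun v => (he v).imp fun z hz => hz.symm⟩

lemma bestApproxFails_veronese {d : ℕ} (c : InnerProductSpace.Core ℂ (⨂[ℂ] _ : Fin d, V))
    (hd : 3 ≤ d) (hg : 2 < genericRank c (veronese V d)) : BestApproxFails c (veronese V d) := by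
  rcases lt_or_ge (Module.finrank ℂ V) 2 with hV | hV
  · obtain ⟨e, he⟩ := exists_forall_eq_smul hV
    exact (not_two_lt_genericRank_tpow c (fun v : V => v) e he hg).elim
  · obtain ⟨f, b, hfb⟩ := exists_isTangentPair hV
    exact bestApproxFails_of_tpow hd c (fun v : V => v) hfb hg

lemma bestApproxFails_veroneseChow {d k : ℕ}
    (c : InnerProductSpace.Core ℂ (⨂[ℂ] _ : Fin k, ⨂[ℂ] _ : Fin d, V)) (hd : 3 ≤ d) (hk : 3 ≤ k)
    (hg : 2 < genericRank c (veroneseChow V d k)) : BestApproxFails c (veroneseChow V d k) := by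
  rcases lt_or_ge (Module.finrank ℂ V) 2 with hV | hV
  · obtain ⟨e, he⟩ := exists_forall_eq_smul hV
    refine (not_two_lt_genericRank_tpow c (fun v : Fin d → V => symProd v) (symProd fun _ => e)
      (fun v => ?_) hg).elim
    choose z hz using he
    refine ⟨∏ i, z (v i), ?_⟩
    rw [← symProdMap_apply, ← symProdMap_apply, ← MultilinearMap.map_smul_univ]
    exact congrArg _ (funext fun i => hz (v i))
  · obtain ⟨f, b, hfb⟩ := exists_isTangentPair_symProd hV (d := d) (by omega)
    exact bestApproxFails_of_tpow hk c (fun v : Fin d → V => symProd v) hfb hg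

/-- In dimension at most `k` the space `Λ^k V` is at most a line. -/
lemma exists_forall_altProd_eq_smul {k : ℕ} (h : Module.finrank ℂ V ≤ k) :
    ∃ e, ∀ v : Fin k → V, ∃ z : ℂ, altProd v = z • e := by
  rcases h.lt_or_eq with h | h
  · refine ⟨0, fun v => ⟨0, ?_⟩⟩
    rw [← altProdMap_apply, AlternatingMap.map_linearDependent, smul_zero]
    intro hv
    have := hv.fintype_card_le_finrank
    rw [Fintype.card_fin] at this
    omega
  · let e := Module.finBasisOfFinrankEq ℂ V h
    refine ⟨altProdMap V k e, fun v => ⟨e.det v, ?_⟩⟩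
    have h1 : altProdMap V k =
        (LinearMap.toSpanSingleton ℂ _ (altProdMap V k e)).compAlternatingMap e.det := by
      refine Module.Basis.ext_alternating e fun i hi => ?_
      let σ : Equiv.Perm (Fin k) := Equiv.ofBijective i (Finite.injective_iff_bijective.1 hi)
      change altProdMap V k (e ∘ σ) = e.det (e ∘ σ) • altProdMap V k e
      rw [AlternatingMap.map_perm, AlternatingMap.map_perm, Module.Basis.det_self]
      rw [Units.smul_def, Units.smul_def, ← Int.cast_smul_eq_zsmul ℂ]
      simp
    rw [← altProdMap_apply, h1]
    simp [Module.Basis.det_self]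

lemma bestApproxFails_veroneseGrassmann {d k : ℕ}
    (c : InnerProductSpace.Core ℂ (⨂[ℂ] _ : Fin d, ⨂[ℂ] _ : Fin k, V)) (hd : 3 ≤ d) (hk : 3 ≤ k)
    (hg : 2 < genericRank c (veroneseGrassmann V d k)) :
    BestApproxFails c (veroneseGrassmann V d k) := by
  rcases le_or_gt (Module.finrank ℂ V) k with hV | hV
  · obtain ⟨e, he⟩ := exists_forall_altProd_eq_smul hV
    exact (not_two_lt_genericRank_tpow c (fun v : Fin k → V => altProd v) e he hg).elim
  · obtain ⟨f, b, hfb⟩ := exists_isTangentPair_altProd (by omega) hV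
    exact bestApproxFails_of_tpow hd c (fun v : Fin k → V => altProd v) hfb hg

end VeroneseCases

/-! ### The three-term Plücker relation -/

section Plucker

variable {k : ℕ}

/-- The determinant as a bilinear function of its rows `i` and `j`, the others being those of
`R`. -/
def twoRowDet (R : Fin k → Fin k → ℂ) {i j : Fin k} (hij : i ≠ j) :
    (Fin k → ℂ) →ₗ[ℂ] (Fin k → ℂ) →ₗ[ℂ] ℂ :=
  LinearMap.mk₂ ℂ (fun p q =>
      Matrix.detRowAlternating (Function.update (Function.update R i p) j q))
    (fun p p' q => by
      simp only [Function.update_comm hij]; rw [AlternatingMap.map_update_add])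
    (fun z p q => by
      simp only [Function.update_comm hij]; rw [AlternatingMap.map_update_smul])
    (fun p q q' => by rw [AlternatingMap.map_update_add])
    (fun z p q => by rw [AlternatingMap.map_update_smul])

variable (R : Fin k → Fin k → ℂ) {i j : Fin k} (hij : i ≠ j)

lemma twoRowDet_apply (p q : Fin k → ℂ) : twoRowDet R hij p q =
    Matrix.detRowAlternating (Function.update (Function.update R i p) j q) := rfl

lemma twoRowDet_self (p : Fin k → ℂ) : twoRowDet R hij p p = 0 := by
  rw [twoRowDet_apply]
  exact AlternatingMap.map_eq_zero_of_eq _ _ (by simp [Function.update_of_ne hij]) hij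

lemma twoRowDet_swap (p q : Fin k → ℂ) : twoRowDet R hij p q = -twoRowDet R hij q p := by
  have h := twoRowDet_self R hij (p + q)
  simp only [map_add, LinearMap.add_apply, twoRowDet_self] at h
  linear_combination h

lemma twoRowDet_row_left {a : Fin k} (hi : a ≠ i) (hj : a ≠ j) (q : Fin k → ℂ) :
    twoRowDet R hij (R a) q = 0 := by
  rw [twoRowDet_apply]
  refine AlternatingMap.map_eq_zero_of_eq _ _ (i := i) (j := a) ?_ hi.symm
  simp [Function.update_of_ne hij, Function.update_of_ne hi, Function.update_of_ne hj]

lemma twoRowDet_row_right {a : Fin k} (hi : a ≠ i) (hj : a ≠ j) (p : Fin k → ℂ) :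
    twoRowDet R hij p (R a) = 0 := by
  rw [twoRowDet_swap, twoRowDet_row_left R hij hi hj, neg_zero]

lemma twoRowDet_plucker_of_ne {p q : Fin k → ℂ} (h : twoRowDet R hij p q ≠ 0) (r s : Fin k → ℂ) :
    twoRowDet R hij p q * twoRowDet R hij r s - twoRowDet R hij p r * twoRowDet R hij q s +
      twoRowDet R hij p s * twoRowDet R hij q r = 0 := by
  set B := twoRowDet R hij with hB
  set N := Function.update (Function.update R i p) j q with hN
  have hli : LinearIndependent ℂ N := by
    by_contra hdep
    exact h ((Matrix.detRowAlternating (R := ℂ)).map_linearDependent N hdep)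
  have hspan : Submodule.span ℂ (Set.range N) = ⊤ :=
    haveI : Nonempty (Fin k) := ⟨i⟩
    hli.span_eq_top_of_card_eq_finrank (by simp)
  -- The relation is linear in `r`, and the rows of `N` form a basis.
  have hL : B p q • B.flip s - B q s • B p + B p s • B q = 0 := by
    refine LinearMap.ext_on_range hspan fun a => ?_
    simp only [LinearMap.add_apply, LinearMap.sub_apply, LinearMap.smul_apply,
      LinearMap.flip_apply, smul_eq_mul, LinearMap.zero_apply]
    by_cases haj : a = j
    · have : N a = q := by simp [hN, haj]
      rw [this, hB, twoRowDet_self]; ring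
    by_cases hai : a = i
    · have : N a = p := by simp [hN, hai, Function.update_of_ne hij]
      rw [this, hB, twoRowDet_self, twoRowDet_swap R hij q p]; ring
    · have : N a = R a := by
        rw [hN, Function.update_of_ne haj, Function.update_of_ne hai]
      rw [this, hB, twoRowDet_row_left R hij hai haj, twoRowDet_row_right R hij hai haj,
        twoRowDet_row_right R hij hai haj]; ring
  have := LinearMap.congr_fun hL r
  simp only [LinearMap.add_apply, LinearMap.sub_apply, LinearMap.smul_apply,
      LinearMap.flip_apply, smul_eq_mul, LinearMap.zero_apply] at this
  linear_combination this

/-- The three-term Plücker relation. -/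
lemma twoRowDet_plucker (p q r s : Fin k → ℂ) :
    twoRowDet R hij p q * twoRowDet R hij r s - twoRowDet R hij p r * twoRowDet R hij q s +
      twoRowDet R hij p s * twoRowDet R hij q r = 0 := by
  by_cases h1 : twoRowDet R hij p q = 0
  · by_cases h2 : twoRowDet R hij p r = 0
    · by_cases h3 : twoRowDet R hij p s = 0
      · simp [h1, h2, h3]
      · have := twoRowDet_plucker_of_ne R hij h3 q r
        rw [h1, h2] at this ⊢
        linear_combination this
    · have := twoRowDet_plucker_of_ne R hij h2 q s
      rw [twoRowDet_swap R hij r q] at this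
      linear_combination -this
  · exact twoRowDet_plucker_of_ne R hij h1 r s

end Plucker

/-! ### Grassmann varieties -/

section Grassmann

variable {V : Type*} [AddCommGroup V] [Module ℂ V] {k : ℕ}

/-- Decomposable alternating tensors satisfy the three-term Plücker relation, here for the values
of the tensor on covectors that differ in two positions only. -/
lemma evalProd_altProd_plucker (ζ : Fin k → Module.Dual ℂ V) {i j : Fin k} (hij : i ≠ j)
    (p q r s : Module.Dual ℂ V) (z : ℂ) (v : Fin k → V) :
    let T : Module.Dual ℂ V → Module.Dual ℂ V → ℂ := fun x y =>
      evalProd (Function.update (Function.update ζ i x) j y) (z • altProd v)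
    T p q * T r s - T p r * T q s + T p s * T q r = 0 := by
  intro T
  have hT : ∀ x y, T x y = z * ((k.factorial : ℂ)⁻¹ * twoRowDet (fun a c => ζ a (v c)) hij
      (fun c => x (v c)) (fun c => y (v c))) := by
    intro x y
    simp only [T, map_smul, smul_eq_mul]
    rw [evalProd_altProd, twoRowDet_apply]
    congr 2
    change Matrix.det _ = Matrix.det _
    congr 1
    ext a c
    rw [Matrix.of_apply]
    by_cases haj : a = j
    · subst haj; simp
    · rw [Function.update_of_ne haj, Function.update_of_ne haj]
      by_cases hai : a = i
      · subst hai; simp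
      · rw [Function.update_of_ne hai, Function.update_of_ne hai]
  have := twoRowDet_plucker (fun a c => ζ a (v c)) hij (fun c => p (v c)) (fun c => q (v c))
    (fun c => r (v c)) (fun c => s (v c))
  simp only [hT]
  linear_combination (z * (k.factorial : ℂ)⁻¹) ^ 2 * this

/-- If a vector `e ≠ 0` of the span of `v₁, …, v_k` is killed by `η₁, …, η_k`, then so is
`v₁ ∧ ⋯ ∧ v_k` by `η₁ ⊗ ⋯ ⊗ η_k`. -/
lemma evalProd_altProd_eq_zero {η : Fin k → Module.Dual ℂ V} {v : Fin k → V} {e : V} (he : e ≠ 0)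
    (hev : e ∈ Submodule.span ℂ (Set.range v)) (hη : ∀ i, η i e = 0) :
    evalProd η (altProd v) = 0 := by
  rw [evalProd_altProd]
  obtain ⟨c, rfl⟩ := (Submodule.mem_span_range_iff_exists_fun ℂ).1 hev
  have : ∃ w ≠ 0, Matrix.mulVec (Matrix.of fun i j => η i (v j)) w = 0 := by
    refine ⟨c, ?_, ?_⟩
    · rintro rfl
      simp at he
    · ext i
      have := hη i
      simp only [map_sum, map_smul, smul_eq_mul] at this
      simpa [Matrix.mulVec, dotProduct, mul_comm] using this
  rw [Matrix.exists_mulVec_eq_zero_iff.1 this, mul_zero]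

/-- The determinant of a matrix all of whose rows but the first are those of the identity. -/
lemma det_of_eq_one_rows {n : ℕ} (M : Matrix (Fin (n + 1)) (Fin (n + 1)) ℂ)
    (h : ∀ i, i ≠ 0 → ∀ j, M i j = if i = j then 1 else 0) : M.det = M 0 0 := by
  rw [Matrix.det_of_isUpperTriangular, Fin.prod_univ_succ]
  · simp [h _ (Fin.succ_ne_zero _)]
  · intro i j hij
    have hi : i ≠ 0 := by
      rintro rfl
      exact absurd hij (by simp)
    rw [h i hi, if_neg]
    exact fun hh => absurd hij (by simp [hh])

/-- The tangent vector of the cone over the Grassmann variety in question is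
`f₀ ∧ e₁ ∧ e₂ ∧ ⋯ + e₀ ∧ f₁ ∧ e₂ ∧ ⋯ + e₀ ∧ e₁ ∧ f₂ ∧ ⋯`, where the dots stand for
`e₃ ∧ ⋯ ∧ e_{k-1}`. If it were the sum of two decomposable tensors `x₁ ∧ ⋯ ∧ x_k` and
`y₁ ∧ ⋯ ∧ y_k`, then its contraction with any `ξ` that vanishes on the `x_j` would be decomposable,
and a Plücker relation gives `ξ(e₀) = 0`. Hence `e₀` lies in the span of the `x_j` and of the
`y_j`, and the tensor vanishes whenever it is evaluated on covectors that vanish on `e₀`; but the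
first summand does not. -/
theorem bestApproxFails_grassmann [FiniteDimensional ℂ V]
    (c : InnerProductSpace.Core ℂ (⨂[ℂ] _ : Fin k, V)) (hk : 3 ≤ k)
    (hV : k + 3 ≤ Module.finrank ℂ V) (hg : 2 < genericRank c (grassmann V k)) :
    BestApproxFails c (grassmann V k) := by
  obtain ⟨e', δ', hδ'⟩ := exists_linearIndependent_fin hV
  obtain ⟨n, rfl⟩ : ∃ n, k = n + 3 := ⟨k - 3, by omega⟩
  let e : Fin (n + 3) → V := fun i => e' (Fin.castAdd 3 i)
  let b : Fin (n + 3) → V := fun i => if h : i.val < 3 then e' (Fin.natAdd _ ⟨i, h⟩) else 0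
  let ε : Fin (n + 3) → Module.Dual ℂ V := fun i => δ' (Fin.castAdd 3 i)
  let φ : Fin 3 → Module.Dual ℂ V := fun i => δ' (Fin.natAdd _ i)
  have hεe : ∀ i j, ε i (e j) = if i = j then 1 else 0 := by
    intro i j; simp [ε, e, hδ']
  have hεb : ∀ i j, ε i (b j) = 0 := by
    intro i j
    simp only [ε, b]
    split_ifs
    · rw [hδ', if_neg]
      intro h
      have := congrArg Fin.val h
      simp at this
      omega
    · simp
  have hφe : ∀ i j, φ i (e j) = 0 := by
    intro i j
    simp only [φ, e]
    rw [hδ', if_neg]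
    intro h
    have := congrArg Fin.val h
    simp at this
    omega
  have hφb : ∀ (i : Fin 3) (j : Fin (n + 3)), φ i (b j) = if i.val = j.val then 1 else 0 := by
    intro i j
    simp only [φ, b]
    split_ifs with h1 h2 h2
    · rw [hδ', if_pos]
      ext; simp [h2]
    · rw [hδ', if_neg]
      intro h
      have := congrArg Fin.val h
      simp at this
      exact h2 this
    · omega
    · simp
  let w : Fin (n + 3) → Fin (n + 3) → V := fun i => Function.update e i (b i)
  set A := ∑ i, altProd (w i) with hA
  have hφw : ∀ (a : Fin 3) (i : Fin (n + 3)), a.val ≠ i.val → ∀ j, φ a (w i j) = 0 := by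
    intro a i hai j
    simp only [w]
    by_cases hj : j = i
    · subst hj; simp [hφb, hai]
    · rw [Function.update_of_ne hj, hφe]
  have hεw : ∀ i j, ε i (w i j) = 0 := by
    intro i j
    simp only [w]
    by_cases hj : j = i
    · subst hj; simp [hεb]
    · rw [Function.update_of_ne hj, hεe, if_neg (Ne.symm hj)]
  have hzero : ∀ (η : Fin (n + 3) → Module.Dual ℂ V) (i a : Fin (n + 3)),
      (∀ j, η a (w i j) = 0) → evalProd η (altProd (w i)) = 0 := by
    intro η i a h
    rw [evalProd_altProd, Matrix.det_eq_zero_of_row_eq_zero a (by simpa using h), mul_zero]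
  have hone : ∀ (η : Fin (n + 3) → Module.Dual ℂ V) (i : Fin (n + 3)),
      (∀ a, a ≠ 0 → ∀ j, η a (w i j) = if a = j then 1 else 0) →
      evalProd η (altProd (w i)) = ((n + 3).factorial : ℂ)⁻¹ * η 0 (w i 0) := by
    intro η i h
    rw [evalProd_altProd, det_of_eq_one_rows _ (by simpa using h), Matrix.of_apply]
  have v0 : ((0 : Fin (n + 3)) : ℕ) = 0 := rfl
  have v1 : ((1 : Fin (n + 3)) : ℕ) = 1 := by simp
  have v2 : ((2 : Fin (n + 3)) : ℕ) = 2 := by simp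
  have h12 : (1 : Fin (n + 3)) ≠ 2 := by rw [Ne, Fin.ext_iff, v1, v2]; decide
  have h01 : (0 : Fin (n + 3)) ≠ 1 := by rw [Ne, Fin.ext_iff, v0, v1]; decide
  have h02 : (0 : Fin (n + 3)) ≠ 2 := by rw [Ne, Fin.ext_iff, v0, v2]; decide
  -- The covectors `ξ, x, y, e₃*, e₄*, …`.
  let rows : Module.Dual ℂ V → Module.Dual ℂ V → Module.Dual ℂ V → Fin (n + 3) → Module.Dual ℂ V :=
    fun ξ x y => Function.update (Function.update (Function.update ε 0 ξ) 1 x) 2 y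
  have hr0 : ∀ ξ x y, rows ξ x y 0 = ξ := fun ξ x y => by
    simp only [rows]
    rw [Function.update_of_ne h02, Function.update_of_ne h01, Function.update_self]
  have hr1 : ∀ ξ x y, rows ξ x y 1 = x := fun ξ x y => by
    simp only [rows]
    rw [Function.update_of_ne h12, Function.update_self]
  have hr2 : ∀ ξ x y, rows ξ x y 2 = y := fun ξ x y => by
    simp only [rows]
    rw [Function.update_self]
  have hr : ∀ ξ x y a, a ≠ 0 → a ≠ 1 → a ≠ 2 → rows ξ x y a = ε a := fun ξ x y a h0 h1 h2 => by
    simp only [rows]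
    rw [Function.update_of_ne h2, Function.update_of_ne h1, Function.update_of_ne h0]
  have hne : ∀ {i a : Fin (n + 3)}, i ≠ a → a.val ≠ i.val := fun h h' => h (Fin.ext h'.symm)
  have hεw' : ∀ a i, a ≠ i → ∀ j, ε a (w i j) = if a = j then 1 else 0 := by
    intro a i hai j
    simp only [w]
    by_cases hj : j = i
    · subst hj; simp [hεb, hai]
    · rw [Function.update_of_ne hj, hεe]
  have hφw' : ∀ (a : Fin 3) (i : Fin (n + 3)), a.val = i.val → ∀ j,
      φ a (w i j) = if i = j then 1 else 0 := by
    intro a i hai j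
    simp only [w]
    by_cases hj : j = i
    · subst hj; simp [hφb, hai]
    · rw [Function.update_of_ne hj, hφe, if_neg (Ne.symm hj)]
  have hw0 : ∀ i, i ≠ 0 → w i 0 = e 0 := fun i hi => by
    simp only [w]; rw [Function.update_of_ne hi.symm]
  have T12 : ∀ ξ, evalProd (rows ξ (ε 1) (φ 2)) A = ((n + 3).factorial : ℂ)⁻¹ * ξ (e 0) := by
    intro ξ
    rw [hA, map_sum, Finset.sum_eq_single 2, hone, hr0, hw0 _ h02.symm]
    · intro a ha j
      by_cases ha1 : a = 1
      · subst ha1; rw [hr1, hεw' _ _ h12]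
      by_cases ha2 : a = 2
      · subst ha2; rw [hr2, hφw' _ _ v2.symm]
      · rw [hr _ _ _ _ ha ha1 ha2, hεw' _ _ ha2]
    · intro i _ hi
      refine hzero _ _ 2 fun j => ?_
      rw [hr2, hφw _ _ (by have := hne hi; rw [v2] at this; exact this)]
    · simp
  have T21 : ∀ ξ, evalProd (rows ξ (φ 1) (ε 2)) A = ((n + 3).factorial : ℂ)⁻¹ * ξ (e 0) := by
    intro ξ
    rw [hA, map_sum, Finset.sum_eq_single 1, hone, hr0, hw0 _ h01.symm]
    · intro a ha j
      by_cases ha1 : a = 1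
      · subst ha1; rw [hr1, hφw' _ _ v1.symm]
      by_cases ha2 : a = 2
      · subst ha2; rw [hr2, hεw' _ _ h12.symm]
      · rw [hr _ _ _ _ ha ha1 ha2, hεw' _ _ ha1]
    · intro i _ hi
      refine hzero _ _ 1 fun j => ?_
      rw [hr1, hφw _ _ (by have := hne hi; rw [v1] at this; exact this)]
    · simp
  have T11 : ∀ ξ, evalProd (rows ξ (ε 1) (φ 1)) A = 0 := by
    intro ξ
    rw [hA, map_sum]
    refine Finset.sum_eq_zero fun i _ => ?_
    by_cases hi : i = 1
    · subst hi
      exact hzero _ _ 1 fun j => by rw [hr1, hεw]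
    · refine hzero _ _ 2 fun j => ?_
      rw [hr2, hφw _ _ (by have := hne hi; rw [v1] at this; exact this)]
  have T22 : ∀ ξ, evalProd (rows ξ (φ 2) (φ 1)) A = 0 := by
    intro ξ
    rw [hA, map_sum]
    refine Finset.sum_eq_zero fun i _ => ?_
    by_cases hi : i = 1
    · subst hi
      exact hzero _ _ 1 fun j => by rw [hr1, hφw _ _ (by rw [v1]; decide)]
    · refine hzero _ _ 2 fun j => ?_
      rw [hr2, hφw _ _ (by have := hne hi; rw [v1] at this; exact this)]
  have hfac : ((n + 3).factorial : ℂ)⁻¹ ≠ 0 :=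
    inv_ne_zero (Nat.cast_ne_zero.2 (Nat.factorial_ne_zero _))
  have hcone : ∀ x ∈ affineCone (grassmann V (n + 3)), ∃ (z : ℂ) (v : Fin (n + 3) → V),
      x = z • altProd v := by
    intro x hx
    rcases mem_affineCone_projImage.1 hx with rfl | ⟨v, z, rfl⟩
    · exact ⟨0, fun _ => 0, by simp⟩
    · exact ⟨z, v, rfl⟩
  have he0 : e 0 ≠ 0 := by
    intro h
    have := hεe 0 0
    simp [h] at this
  -- A summand `x` can be discarded by contracting with a covector `ξ` that vanishes on it.
  have hmem : ∀ (z₁ z₂ : ℂ) (x y : Fin (n + 3) → V), A = z₁ • altProd x + z₂ • altProd y →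
      e 0 ∈ Submodule.span ℂ (Set.range x) := by
    intro z₁ z₂ x y hxy
    by_contra hnot
    obtain ⟨ξ, hξe, hξ⟩ := Submodule.exists_dual_map_eq_bot_of_notMem hnot inferInstance
    have hξx : ∀ j, ξ (x j) = 0 := fun j => by
      have : ξ (x j) ∈ (Submodule.span ℂ (Set.range x)).map ξ :=
        Submodule.mem_map_of_mem (Submodule.subset_span ⟨j, rfl⟩)
      rwa [hξ, Submodule.mem_bot] at this
    have hval : ∀ p q, evalProd (rows ξ p q) A = evalProd (rows ξ p q) (z₂ • altProd y) := by
      intro p q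
      have h0 : evalProd (rows ξ p q) (altProd x) = 0 := by
        rw [evalProd_altProd, Matrix.det_eq_zero_of_row_eq_zero 0, mul_zero]
        intro j
        rw [Matrix.of_apply, hr0, hξx]
      rw [hxy, map_add, map_smul, h0, smul_zero, zero_add]
    have hpl := evalProd_altProd_plucker (Function.update ε 0 ξ) h12 (ε 1) (φ 2) (φ 1) (ε 2) z₂ y
    change evalProd (rows ξ _ _) _ * evalProd (rows ξ _ _) _ -
      evalProd (rows ξ _ _) _ * evalProd (rows ξ _ _) _ +
      evalProd (rows ξ _ _) _ * evalProd (rows ξ _ _) _ = 0 at hpl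
    simp only [← hval, T12, T21, T11, T22] at hpl
    simp [hfac, hξe] at hpl
  refine bestApproxFails_of c hg (A := A) ?_ ?_ ?_
  · have h1 := HasWeakDeriv.multilinear (altProdMap V (n + 3)).toMultilinearMap
      (f := fun i t => e i + t • b i) (b := b) fun i => hasWeakDeriv_line (e i) (b i)
    have h2 : (∑ i, (altProdMap V (n + 3)).toMultilinearMap
        (Function.update (fun j => e j + (0 : ℂ) • b j) i (b i))) = A := by
      rw [hA]
      refine Finset.sum_congr rfl fun i _ => ?_
      rw [← altProdMap_apply]
      simp only [zero_smul, add_zero]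
      rfl
    rw [h2] at h1
    refine HasWeakDeriv.mem_secantVariety c (F := fun v : Fin (n + 3) → V => altProd v)
      (g := fun t i => e i + t • b i) ?_
    simp only [← altProdMap_apply]
    exact h1
  · intro h
    have := eq_zero_of_mem_euclClosure c
      (fun pq : Module.Dual ℂ V × Module.Dual ℂ V => evalProd (rows (ε 0) pq.1 pq.2))
      (fun z => z (ε 1, φ 2) * z (φ 1, ε 2) - z (ε 1, φ 1) * z (φ 2, ε 2) +
        z (ε 1, ε 2) * z (φ 2, φ 1)) (by fun_prop) (fun x hx => ?_) h
    · simp only [T12, T21, T11, T22, hεe] at this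
      simp [hfac] at this
    · obtain ⟨z, v, rfl⟩ := hcone x (mem_secantPoints_one.1 hx)
      exact evalProd_altProd_plucker (Function.update ε 0 (ε 0)) h12 (ε 1) (φ 2) (φ 1) (ε 2) z v
  · rw [mem_secantPoints_two]
    rintro ⟨x', hx, y', hy, hxy⟩
    obtain ⟨z₁, x, rfl⟩ := hcone x' hx
    obtain ⟨z₂, y, rfl⟩ := hcone y' hy
    have hx0 := hmem z₁ z₂ x y hxy
    have hy0 := hmem z₂ z₁ y x (hxy.trans (add_comm _ _))
    have hkill : ∀ i, Function.update ε 0 (φ 0) i (e 0) = 0 := by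
      intro i
      by_cases hi : i = 0
      · subst hi; rw [Function.update_self, hφe]
      · rw [Function.update_of_ne hi, hεe, if_neg hi]
    have hval : evalProd (Function.update ε 0 (φ 0)) A = ((n + 3).factorial : ℂ)⁻¹ := by
      rw [hA, map_sum, Finset.sum_eq_single 0, hone, Function.update_self, hφw' _ _ v0.symm]
      · simp
      · intro a ha j
        rw [Function.update_of_ne ha, hεw' _ _ ha]
      · intro i _ hi
        refine hzero _ _ 0 fun j => ?_
        rw [Function.update_self, hφw _ _ (by have := hne hi; rw [v0] at this; exact this)]
      · simp
    rw [hxy, map_add, map_smul, map_smul, evalProd_altProd_eq_zero he0 hx0 hkill,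
      evalProd_altProd_eq_zero he0 hy0 hkill] at hval
    simp at hval
    exact Nat.factorial_ne_zero _ (by exact_mod_cast hval.symm)

end Grassmann

/-! ### Chow varieties: binary forms, closedness, and tangent vectors -/

section ChowCone

variable {V : Type*} [AddCommGroup V] [Module ℂ V] {d : ℕ}

lemma mem_affineCone_chow (hd : 1 ≤ d) {x : ⨂[ℂ] _ : Fin d, V} :
    x ∈ affineCone (chow V d) ↔ ∃ v : Fin d → V, x = symProd v := by
  have i₀ : Fin d := ⟨0, hd⟩
  constructor
  · intro hx
    rcases mem_affineCone_projImage.1 hx with rfl | ⟨v, z, rfl⟩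
    · refine ⟨0, ?_⟩
      rw [← symProdMap_apply]
      exact (MultilinearMap.map_coord_zero _ i₀ rfl).symm
    · refine ⟨Function.update v i₀ (z • v i₀), ?_⟩
      simp only [← symProdMap_apply]
      rw [MultilinearMap.map_update_smul, Function.update_eq_self]
  · rintro ⟨v, rfl⟩
    rw [← one_smul ℂ (symProd v)]
    exact smul_mem_affineCone (fun v : Fin d → V => symProd v) 1 v

lemma symProd_comp_perm (v : Fin d → V) (σ : Equiv.Perm (Fin d)) :
    symProd (fun i => v (σ i)) = symProd v := by
  rw [symProd, symProd]
  congr 1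
  exact Fintype.sum_equiv (Equiv.mulLeft σ) _ _ fun τ => rfl

/-- The symmetric product of `k` copies of `e₀` and `d - k` copies of `e₁`. -/
def symMonomial (d : ℕ) (e₀ e₁ : V) (k : ℕ) : ⨂[ℂ] _ : Fin d, V :=
  symProd fun i : Fin d => if (i : ℕ) < k then e₀ else e₁

lemma symProd_piecewise (e₀ e₁ : V) (s : Finset (Fin d)) :
    symProd (fun i => if i ∈ s then e₀ else e₁) = symMonomial d e₀ e₁ s.card := by
  have hcard : Fintype.card {i // i ∈ s} = Fintype.card {i : Fin d // (i : ℕ) < s.card} := by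
    have h1 : s.card ≤ d := by simpa using s.card_le_univ
    rw [Fintype.card_coe, Fintype.card_subtype]
    simp [Fin.card_filter_val_lt, h1]
  let e := Fintype.equivOfCardEq hcard
  rw [symMonomial, ← symProd_comp_perm (fun i : Fin d => if (i : ℕ) < s.card then e₀ else e₁)
    e.extendSubtype]
  congr 1
  funext i
  by_cases hi : i ∈ s
  · rw [if_pos hi, if_pos (e.extendSubtype_mem i hi)]
  · rw [if_neg hi, if_neg (e.extendSubtype_not_mem i hi)]

/-- The map from binary forms of degree `d`, written as univariate polynomials, to symmetric
tensors. -/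
def binaryForm (d : ℕ) (e₀ e₁ : V) : Polynomial ℂ →ₗ[ℂ] ⨂[ℂ] _ : Fin d, V :=
  ∑ k ∈ Finset.range (d + 1), (Polynomial.lcoeff ℂ k).smulRight (symMonomial d e₀ e₁ k)

open Polynomial in
lemma binaryForm_prod (e₀ e₁ : V) (α β : Fin d → ℂ) :
    binaryForm d e₀ e₁ (∏ i, (C (α i) * X + C (β i))) = symProd fun i => α i • e₀ + β i • e₁ := by
  have hmon : ∀ (z : ℂ) (k : ℕ), k ≤ d →
      binaryForm d e₀ e₁ (C z * X ^ k) = z • symMonomial d e₀ e₁ k := by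
    intro z k hk
    simp only [binaryForm, LinearMap.sum_apply, LinearMap.smulRight_apply, lcoeff_apply,
      coeff_C_mul_X_pow, ite_smul, zero_smul]
    rw [Finset.sum_ite_eq', if_pos (by simpa [Nat.lt_succ_iff] using hk)]
  have hadd := (symProdMap V d).map_add_univ (fun i => α i • e₀) (fun i => β i • e₁)
  rw [symProdMap_apply] at hadd
  change symProd (fun i => α i • e₀ + β i • e₁) = _ at hadd
  rw [hadd, Finset.prod_add, map_sum, Finset.powerset_univ]
  refine Finset.sum_congr rfl fun s _ => ?_
  have h1 : (∏ i ∈ s, (C (α i) * X)) * ∏ i ∈ Finset.univ \ s, C (β i) =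
      C ((∏ i ∈ s, α i) * ∏ i ∈ Finset.univ \ s, β i) * X ^ s.card := by
    rw [Finset.prod_mul_distrib, Finset.prod_const, map_mul, map_prod, map_prod]
    ring
  rw [h1, hmon _ _ (by simpa using s.card_le_univ), ← symProd_piecewise, ← symProdMap_apply]
  have h2 : s.piecewise (fun i => α i • e₀) (fun i => β i • e₁) =
      fun i => (s.piecewise α β i) • (if i ∈ s then e₀ else e₁) := by
    funext i
    by_cases hi : i ∈ s <;> simp [hi]
  rw [h2, MultilinearMap.map_smul_univ]
  congr 1
  rw [Finset.prod_piecewise]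
  simp

open Polynomial in
lemma exists_eq_prod_linear (f : Polynomial ℂ) (hd : 1 ≤ d) (hf : f.natDegree ≤ d) :
    ∃ α β : Fin d → ℂ, f = ∏ i, (C (α i) * X + C (β i)) := by
  induction d, hd using Nat.le_induction generalizing f with
  | base =>
    obtain ⟨a, b, rfl⟩ := exists_eq_X_add_C_of_natDegree_le_one hf
    exact ⟨fun _ => a, fun _ => b, by simp⟩
  | succ d hd ih =>
    by_cases hlt : f.natDegree ≤ d
    · obtain ⟨α, β, h⟩ := ih f hlt
      exact ⟨Fin.cons 0 α, Fin.cons 1 β, by simp [Fin.prod_univ_succ, ← h]⟩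
    · have hdeg : f.degree ≠ 0 := by
        intro h0
        have := natDegree_eq_zero_iff_degree_le_zero.2 h0.le
        omega
      obtain ⟨r, hr⟩ := Complex.exists_root (f := f) (by
        rw [← natDegree_pos_iff_degree_pos]; omega)
      obtain ⟨g, rfl⟩ := dvd_iff_isRoot.2 hr
      have hg : g ≠ 0 := by rintro rfl; simp at hlt
      rw [natDegree_mul (X_sub_C_ne_zero r) hg, natDegree_X_sub_C] at hf
      obtain ⟨α, β, h⟩ := ih g (by omega)
      refine ⟨Fin.cons 1 α, Fin.cons (-r) β, ?_⟩
      rw [Fin.prod_univ_succ]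
      simp [← h, sub_eq_add_neg]

/-- In dimension at most two the Chow variety is the whole space of symmetric tensors, since every
binary form is a product of linear forms. -/
lemma genericRank_chow_le_one [FiniteDimensional ℂ V] (hd : 1 ≤ d)
    (c : InnerProductSpace.Core ℂ (⨂[ℂ] _ : Fin d, V)) (hV : Module.finrank ℂ V ≤ 2) :
    genericRank c (chow V d) ≤ 1 := by
  obtain ⟨e₀, e₁, he⟩ : ∃ e₀ e₁ : V, ∀ v, ∃ a b : ℂ, v = a • e₀ + b • e₁ := by
    rcases hV.lt_or_eq with h | h
    · obtain ⟨e, he⟩ := exists_forall_eq_smul h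
      refine ⟨e, 0, fun v => ?_⟩
      obtain ⟨z, hz⟩ := he v
      exact ⟨z, 0, by simpa using hz⟩
    · let B := Module.finBasisOfFinrankEq ℂ V h
      refine ⟨B 0, B 1, fun v => ⟨B.repr v 0, B.repr v 1, ?_⟩⟩
      rw [← Fin.sum_univ_two (f := fun i => B.repr v i • B i), B.sum_repr]
  refine mod_cast genericRank_le c (r := 1) fun p hp => ?_
  rw [mem_secantPoints_one, mem_affineCone_chow hd]
  have hsub : linSpan (chow V d) ≤
      (Polynomial.degreeLE ℂ d).map (binaryForm d e₀ e₁) := by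
    refine Submodule.span_le.2 fun x hx => ?_
    obtain ⟨v, rfl⟩ := (mem_affineCone_chow hd).1 hx
    choose α β hv using fun i => he (v i)
    refine ⟨∏ i, (Polynomial.C (α i) * Polynomial.X + Polynomial.C (β i)), ?_, ?_⟩
    · rw [SetLike.mem_coe, Polynomial.mem_degreeLE]
      refine (Polynomial.degree_prod_le _ _).trans ?_
      refine (Finset.sum_le_card_nsmul _ _ 1 fun i _ => Polynomial.degree_linear_le).trans ?_
      simp
    · rw [binaryForm_prod]
      congr 1
      funext i
      exact (hv i).symm
  obtain ⟨f, hf, rfl⟩ := hsub hp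
  rw [SetLike.mem_coe, Polynomial.mem_degreeLE] at hf
  obtain ⟨α, β, rfl⟩ := exists_eq_prod_linear f hd (Polynomial.natDegree_le_iff_degree_le.2 hf)
  exact ⟨_, binaryForm_prod e₀ e₁ α β⟩

lemma symProd_ne_zero {v : Fin d → V} (hv : ∀ i, v i ≠ 0) : symProd v ≠ 0 := by
  obtain ⟨ξ, hξ⟩ := Module.exists_dual_forall_apply_ne_zero (K := ℂ) v hv
  intro h
  have := evalProd_symProd_const ξ v
  rw [h, map_zero] at this
  exact Finset.prod_ne_zero_iff.2 (fun i _ => hξ i) this.symm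

/-- The Chow variety is closed: it is the image of a product of projective spaces. -/
lemma secantVariety_chow_one [FiniteDimensional ℂ V] (hd : 1 ≤ d)
    (c : InnerProductSpace.Core ℂ (⨂[ℂ] _ : Fin d, V)) {p : ⨂[ℂ] _ : Fin d, V}
    (hp : p ∈ secantVariety c (chow V d) 1) : ∃ v : Fin d → V, p = symProd v := by
  rw [secantVariety, mem_euclClosure_iff] at hp
  let : NormedAddCommGroup (⨂[ℂ] _ : Fin d, V) := c.toNormedAddCommGroup
  let : InnerProductSpace ℂ (⨂[ℂ] _ : Fin d, V) := InnerProductSpace.ofCore c.toCore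
  let n := Module.finrank ℂ V
  let B := Module.finBasis ℂ V
  let G : (Fin d → Fin n → ℂ) → ⨂[ℂ] _ : Fin d, V :=
    fun w => symProd fun i => B.equivFun.symm (w i)
  have hGc : Continuous G := by
    have : G = fun w => ∑ κ : Fin d → Fin n, (∏ i, w i (κ i)) • symProd fun i => B (κ i) := by
      funext w
      simp only [G, ← symProdMap_apply, B.equivFun_symm_apply]
      rw [MultilinearMap.map_sum]
      exact Finset.sum_congr rfl fun κ _ => MultilinearMap.map_smul_univ _ _ _
    rw [this]
    fun_prop
  let K : Set (Fin d → Fin n → ℂ) := Set.pi Set.univ fun _ => Metric.sphere 0 1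
  have hK : IsCompact K := isCompact_univ_pi fun _ => isCompact_sphere 0 1
  obtain ⟨δ, hδ, hmin⟩ := hK.exists_forall_le' (f := fun w => ‖G w‖) hGc.norm.continuousOn (a := 0)
    (fun w hw => norm_pos_iff.2 (symProd_ne_zero fun i h0 => by
      have h1 : w i = 0 := B.equivFun.symm.map_eq_zero_iff.1 h0
      have h2 := hw i (Set.mem_univ i)
      rw [h1] at h2
      simp at h2))
  set R := (‖p‖ + 1) / δ with hR
  let T : Set (⨂[ℂ] _ : Fin d, V) :=
    (fun zw : ℂ × (Fin d → Fin n → ℂ) => zw.1 • G zw.2) '' (Metric.closedBall 0 R ×ˢ K) ∪ {0}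
  have hT : IsClosed T := by
    refine (((isCompact_closedBall 0 R).prod hK).image ?_).isClosed.union isClosed_singleton
    exact continuous_fst.smul (hGc.comp continuous_snd)
  have hsub : Metric.ball p 1 ∩ secantPoints (chow V d) 1 ⊆ T := by
    rintro x ⟨hxp, hx⟩
    obtain ⟨v, rfl⟩ := (mem_affineCone_chow hd).1 (mem_secantPoints_one.1 hx)
    by_cases hv : ∃ i, v i = 0
    · obtain ⟨i, hi⟩ := hv
      right
      rw [Set.mem_singleton_iff, ← symProdMap_apply]
      exact MultilinearMap.map_coord_zero _ i hi
    push Not at hv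
    left
    let w : Fin d → Fin n → ℂ := fun i => B.equivFun (v i)
    have hw : ∀ i, ‖w i‖ ≠ 0 := fun i => by simpa [w] using hv i
    let k : Fin d → Fin n → ℂ := fun i => ((‖w i‖ : ℂ))⁻¹ • w i
    have hk : k ∈ K := by
      intro i _
      have := hw i
      simp [k, norm_smul, this]
    have hvk : symProd v = (∏ i, (‖w i‖ : ℂ)) • G k := by
      simp only [G, ← symProdMap_apply]
      rw [← MultilinearMap.map_smul_univ]
      congr 1
      funext i
      have : (‖w i‖ : ℂ) ≠ 0 := by exact_mod_cast hw i
      simp only [k, map_smul, smul_smul, mul_inv_cancel₀ this, one_smul]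
      simp [w]
    refine ⟨(∏ i, (‖w i‖ : ℂ), k), ⟨?_, hk⟩, hvk.symm⟩
    rw [mem_closedBall_zero_iff, hR, le_div_iff₀ hδ]
    have h1 : ‖symProd v‖ ≤ ‖p‖ + 1 := by
      have h2 := norm_sub_norm_le (symProd v) p
      rw [Metric.mem_ball, dist_eq_norm] at hxp
      linarith
    rw [hvk, norm_smul] at h1
    exact (mul_le_mul_of_nonneg_left (hmin k hk) (norm_nonneg _)).trans h1
  have hpT : p ∈ T := hT.closure_subset_iff.2 hsub
    (Metric.isOpen_ball.inter_closure ⟨Metric.mem_ball_self one_pos, hp⟩)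
  rw [← mem_affineCone_chow hd]
  rcases hpT with ⟨⟨z, w⟩, _, rfl⟩ | rfl
  · exact smul_mem_affineCone (fun v : Fin d → V => symProd v) z _
  · exact zero_mem_affineCone _

/-- A tangent vector `∑ i, v₁ ∘ ⋯ ∘ v'_i ∘ ⋯ ∘ v_d` of the cone over the Chow variety, viewed as a
form `P` on the dual space, serves to show the failure of best approximation as soon as `P` is not a
sum of two products of linear forms. -/
lemma bestApproxFails_chow_of [FiniteDimensional ℂ V] (hd : 1 ≤ d)
    (c : InnerProductSpace.Core ℂ (⨂[ℂ] _ : Fin d, V)) (hg : 2 < genericRank c (chow V d))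
    (v v' : Fin d → V)
    (h : ∀ P : Module.Dual ℂ V → ℂ,
      (∀ ξ, P ξ = ∑ i, ξ (v' i) * ∏ j ∈ Finset.univ.erase i, ξ (v j)) →
      ∀ x y : Fin d → V, ¬ ∀ ξ, P ξ = ∏ i, ξ (x i) + ∏ i, ξ (y i)) :
    BestApproxFails c (chow V d) := by
  set A : ⨂[ℂ] _ : Fin d, V := ∑ i, symProd (Function.update v i (v' i)) with hA
  have hP := h (fun ξ => evalProd (fun _ => ξ) A) fun ξ => by
    rw [hA, map_sum]
    refine Finset.sum_congr rfl fun i _ => ?_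
    rw [evalProd_symProd_const, ← Finset.mul_prod_erase Finset.univ _ (Finset.mem_univ i),
      Function.update_self]
    congr 1
    refine Finset.prod_congr rfl fun j hj => ?_
    rw [Function.update_of_ne (Finset.ne_of_mem_erase hj)]
  refine bestApproxFails_of c hg (A := A) ?_ ?_ ?_
  · have h1 := HasWeakDeriv.multilinear (symProdMap V d)
      (f := fun i t => v i + t • v' i) (b := v') fun i => hasWeakDeriv_line (v i) (v' i)
    simp only [symProdMap_apply, zero_smul, add_zero] at h1
    exact HasWeakDeriv.mem_secantVariety c (F := fun v : Fin d → V => symProd v)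
      (g := fun t i => v i + t • v' i) h1
  · intro hA1
    obtain ⟨x, hx⟩ := secantVariety_chow_one hd c hA1
    refine hP x 0 fun ξ => ?_
    rw [hx, evalProd_symProd_const]
    simp [show d ≠ 0 by omega]
  · rw [mem_secantPoints_two]
    rintro ⟨x', hx, y', hy, hxy⟩
    obtain ⟨x, rfl⟩ := (mem_affineCone_chow hd).1 hx
    obtain ⟨y, rfl⟩ := (mem_affineCone_chow hd).1 hy
    refine hP x y fun ξ => ?_
    rw [hxy, map_add, evalProd_symProd_const, evalProd_symProd_const]

end ChowCone

/-! ### Chow varieties in dimension at least four -/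

section ChowDimFour

/-- The Leibniz sum for a product with a first factor split off. -/
lemma sum_mul_prod_erase_succ {n : ℕ} (f f' : Fin (n + 1) → ℂ) :
    ∑ i, f' i * ∏ j ∈ Finset.univ.erase i, f j =
      f' 0 * ∏ i : Fin n, f i.succ +
        f 0 * ∑ i : Fin n, f' i.succ * ∏ j ∈ Finset.univ.erase i, f j.succ := by
  rw [Fin.sum_univ_succ, Finset.mul_sum]
  congr 1
  · congr 1
    rw [Fin.univ_succ, Finset.erase_cons, Finset.prod_map]
    rfl
  · refine Finset.sum_congr rfl fun i _ => ?_
    have : Finset.univ.erase i.succ =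
        insert 0 ((Finset.univ.erase i).map (Fin.succEmb n)) := by
      ext j
      refine Fin.cases ?_ (fun j => ?_) j
      · simp [(Fin.succ_ne_zero i).symm]
      · simp [Fin.succ_ne_zero]
    rw [this, Finset.prod_insert (by simp [Fin.succ_ne_zero]), Finset.prod_map]
    simp only [Fin.coe_succEmb]
    ring

/-- If `x^k (wyz + xz² + x²y) = ∏ L + ∏ M`, then no `L i` involves `w`: on the hyperplane
`L i = 0` the form would be a product of linear forms `M j`, and one of these would not involve
`x`. -/
lemma coeff_eq_zero_of_form_eq {k d : ℕ} {a b c e a' b' c' e' : Fin d → ℂ}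
    (h : ∀ w x y z : ℂ, x ^ k * (w * y * z + x * z ^ 2 + x ^ 2 * y) =
      ∏ i, (w * a i + x * b i + y * c i + z * e i) +
        ∏ i, (w * a' i + x * b' i + y * c' i + z * e' i)) (i : Fin d) : a i = 0 := by
  by_contra ha
  obtain ⟨p, q, r, hpqr⟩ : ∃ p q r : ℂ, ∀ x y z : ℂ,
      (p * x + q * y + r * z) * a i + x * b i + y * c i + z * e i = 0 :=
    ⟨-b i / a i, -c i / a i, -e i / a i, fun x y z => by field_simp; ring⟩
  have h1 : ∀ x y z : ℂ,
      x ^ k * ((p * x + q * y + r * z) * y * z + x * z ^ 2 + x ^ 2 * y) =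
        ∏ i, ((p * x + q * y + r * z) * a' i + x * b' i + y * c' i + z * e' i) := by
    intro x y z
    rw [h, Finset.prod_eq_zero (Finset.mem_univ i) (hpqr x y z), zero_add]
  have h2 := (h1 1 0 0).symm
  simp only [mul_zero, add_zero, mul_one, ne_eq, OfNat.ofNat_ne_zero, not_false_eq_true, zero_pow,
    one_mul, zero_mul] at h2
  obtain ⟨j, -, hj⟩ := Finset.prod_eq_zero_iff.1 h2
  -- the factor `M j` restricted to the hyperplane is a form in `y, z` only, and has a zero
  obtain ⟨y, z, hyz, hM⟩ : ∃ y z : ℂ, (y ≠ 0 ∨ z ≠ 0) ∧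
      y * (q * a' j + c' j) + z * (r * a' j + e' j) = 0 := by
    by_cases hr : r * a' j + e' j = 0
    · exact ⟨0, 1, Or.inr one_ne_zero, by rw [hr]; ring⟩
    · exact ⟨r * a' j + e' j, -(q * a' j + c' j), Or.inl hr, by ring⟩
  have h3 : ∀ x : ℂ, x ≠ 0 → (p * x + q * y + r * z) * y * z + x * z ^ 2 + x ^ 2 * y = 0 := by
    intro x hx
    have h4 := h1 x y z
    rw [Finset.prod_eq_zero (Finset.mem_univ j)
      (by linear_combination x * hj + hM)] at h4
    exact (mul_eq_zero.1 h4).resolve_left (pow_ne_zero k hx)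
  have e1 := h3 1 one_ne_zero
  have e2 := h3 (-1) (by norm_num)
  have e3 := h3 2 two_ne_zero
  have hy : y = 0 := by linear_combination (-1 / 2 : ℂ) * e1 + (1 / 6 : ℂ) * e2 + (1 / 3 : ℂ) * e3
  have hz : z = 0 := by
    rw [hy] at e1
    simpa using e1
  simp [hy, hz] at hyz

variable {V : Type*} [AddCommGroup V] [Module ℂ V] [FiniteDimensional ℂ V]

/-- In dimension at least four: the tangent vector is the form `x^{d-3} (wyz + xz² + x²y)`. -/
lemma bestApproxFails_chow_of_four_le {d : ℕ} (hd : 3 ≤ d)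
    (c : InnerProductSpace.Core ℂ (⨂[ℂ] _ : Fin d, V)) (hV : 4 ≤ Module.finrank ℂ V)
    (hg : 2 < genericRank c (chow V d)) : BestApproxFails c (chow V d) := by
  obtain ⟨k, rfl⟩ := Nat.exists_eq_add_of_le' hd
  obtain ⟨e, δ, hδ⟩ := exists_linearIndependent_fin hV
  refine bestApproxFails_chow_of (by omega) c hg
    (Fin.cons (e 1) (Fin.cons (e 2) (Fin.cons (e 3) fun _ => e 1)))
    (Fin.cons (e 0) (Fin.cons (e 3) (Fin.cons (e 1) fun _ => 0))) fun P hP u u' hu => ?_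
  have h : ∀ w x y z : ℂ, x ^ k * (w * y * z + x * z ^ 2 + x ^ 2 * y) =
      ∏ i, (w * δ 0 (u i) + x * δ 1 (u i) + y * δ 2 (u i) + z * δ 3 (u i)) +
        ∏ i, (w * δ 0 (u' i) + x * δ 1 (u' i) + y * δ 2 (u' i) + z * δ 3 (u' i)) := by
    intro w x y z
    set ξ := w • δ 0 + x • δ 1 + y • δ 2 + z • δ 3 with hξ
    have h0 : ξ (e 0) = w := by simp [hξ, hδ]
    have h1 : ξ (e 1) = x := by simp [hξ, hδ]
    have h2 : ξ (e 2) = y := by simp [hξ, hδ]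
    have h3 : ξ (e 3) = z := by simp [hξ, hδ]
    have h4 := hu ξ
    rw [hP, sum_mul_prod_erase_succ, sum_mul_prod_erase_succ, sum_mul_prod_erase_succ] at h4
    simp only [Fin.prod_univ_succ, Fin.cons_zero, Fin.cons_succ, h0, h1, h2, h3, map_zero, zero_mul,
      Finset.sum_const_zero, mul_zero, add_zero, Finset.prod_const, Finset.card_univ,
      Fintype.card_fin] at h4
    simp only [hξ, LinearMap.add_apply, LinearMap.smul_apply, smul_eq_mul] at h4
    simp only [Fin.prod_univ_succ]
    rw [← h4]
    ring
  have ha := coeff_eq_zero_of_form_eq h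
  have ha' := coeff_eq_zero_of_form_eq fun w x y z => (h w x y z).trans (add_comm _ _)
  have e1 := h 1 1 1 1
  have e0 := h 0 1 1 1
  simp only [ha, ha', mul_zero] at e1 e0
  rw [← e0] at e1
  norm_num at e1

end ChowDimFour

/-! ### A tangent form in three variables -/

section ChowForm

/-- The factorization of `yⁿ - xⁿ` into linear forms. -/
lemma sub_pow_eq_prod_primitiveRoot {n : ℕ} {ζ : ℂ} (hζ : IsPrimitiveRoot ζ n) (hn : n ≠ 0)
    (x y : ℂ) : y ^ n - x ^ n = ∏ j : Fin n, (y - ζ ^ (j : ℕ) * x) := by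
  have hpos := Nat.pos_of_ne_zero hn
  rw [hζ.pow_sub_pow_eq_prod_sub_mul y x hpos]
  symm
  refine Finset.prod_nbij (fun j : Fin n => ζ ^ (j : ℕ)) (fun j _ => ?_) (fun j _ k _ hjk => ?_)
    (fun z hz => ?_) fun j _ => rfl
  · rw [Polynomial.mem_nthRootsFinset hpos, ← pow_mul, mul_comm (j : ℕ), pow_mul, hζ.pow_eq_one,
      one_pow]
  · exact Fin.ext (hζ.pow_inj j.2 k.2 hjk)
  · rw [Finset.mem_coe, Polynomial.mem_nthRootsFinset hpos] at hz
    have : NeZero n := ⟨hn⟩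
    obtain ⟨k, hk, rfl⟩ := hζ.eq_pow_of_pow_eq_one hz
    exact ⟨⟨k, hk⟩, by simp, rfl⟩

open Polynomial in
/-- The product of all factors but one of `yⁿ - xⁿ = ∏ (y - ζ^j x)`. -/
lemma prod_erase_sub_pow_mul {n : ℕ} [NeZero n] {ζ : ℂ} (hζ : IsPrimitiveRoot ζ n) (x y : ℂ)
    (i : Fin n) :
    ∏ j ∈ Finset.univ.erase i, (y - ζ ^ (j : ℕ) * x) =
      ∑ k ∈ Finset.range n, (ζ ^ (i : ℕ) * x) ^ k * y ^ (n - 1 - k) := by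
  have hroot : ∀ j : Fin n, (ζ ^ (j : ℕ)) ^ n = 1 := fun j => by
    rw [← pow_mul, mul_comm (j : ℕ), pow_mul, hζ.pow_eq_one, one_pow]
  have hprod := sub_pow_eq_prod_primitiveRoot hζ (NeZero.ne n) x
  have hpow : (ζ ^ (i : ℕ) * x) ^ n = x ^ n := by
    rw [mul_pow, hroot, one_mul]
  have key : (∏ j ∈ Finset.univ.erase i, (X - C (ζ ^ (j : ℕ) * x))) =
      ∑ k ∈ Finset.range n, C (ζ ^ (i : ℕ) * x) ^ k * X ^ (n - 1 - k) := by
    refine mul_left_cancel₀ (X_sub_C_ne_zero (ζ ^ (i : ℕ) * x)) ?_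
    rw [Finset.mul_prod_erase Finset.univ (fun j : Fin n => X - C (ζ ^ (j : ℕ) * x))
      (Finset.mem_univ i)]
    have h1 := (Commute.all (C (ζ ^ (i : ℕ) * x)) X).geom_sum₂_mul n
    refine Polynomial.funext fun y => ?_
    have h2 := congrArg (eval y) h1
    simp only [eval_mul, eval_sub, eval_pow, eval_C, eval_X, hpow] at h2
    simp only [eval_mul, eval_prod, eval_sub, eval_C, eval_X, ← hprod]
    linear_combination h2
  have := congrArg (eval y) key
  simpa [eval_prod, eval_finsetSum] using this

lemma sum_pow_primitiveRoot {n : ℕ} {ζ : ℂ} (hζ : IsPrimitiveRoot ζ n) (m : ℕ) :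
    ∑ i : Fin n, (ζ ^ (i : ℕ)) ^ m = if n ∣ m then (n : ℂ) else 0 := by
  have h : ∀ i : Fin n, (ζ ^ (i : ℕ)) ^ m = (ζ ^ m) ^ (i : ℕ) := fun i => by
    rw [← pow_mul, ← pow_mul, mul_comm]
  simp only [h, Fin.sum_univ_eq_sum_range (fun i => (ζ ^ m) ^ i) n]
  split_ifs with hm
  · rw [(hζ.pow_eq_one_iff_dvd m).2 hm]
    simp
  · have h1 : ζ ^ m ≠ 1 := fun h => hm ((hζ.pow_eq_one_iff_dvd m).1 h)
    rw [geom_sum_eq h1, ← pow_mul, mul_comm, pow_mul, hζ.pow_eq_one]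
    simp

/-- The interpolation behind the tangent vector in dimension three: a suitable choice of the
directions yields the monomials `w x^{n-1}` and `x³ y^{n-3}`. -/
lemma sum_mul_prod_erase_primitiveRoot {n : ℕ} (hn : 3 ≤ n) {ζ : ℂ} (hζ : IsPrimitiveRoot ζ n)
    (w x y : ℂ) :
    ∑ i : Fin n, (ζ ^ (i : ℕ) / n * w + (ζ ^ (i : ℕ)) ^ (n - 2) / n * x) *
      ∏ j ∈ Finset.univ.erase i, (y - ζ ^ (j : ℕ) * x) =
      w * x ^ (n - 1) + x ^ 3 * y ^ (n - 3) := by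
  have : NeZero n := ⟨by omega⟩
  have hn0 : (n : ℂ) ≠ 0 := by exact_mod_cast NeZero.ne n
  simp only [prod_erase_sub_pow_mul hζ, Finset.mul_sum]
  rw [Finset.sum_comm]
  have h : ∀ k ∈ Finset.range n,
      ∑ i : Fin n, (ζ ^ (i : ℕ) / n * w + (ζ ^ (i : ℕ)) ^ (n - 2) / n * x) *
        ((ζ ^ (i : ℕ) * x) ^ k * y ^ (n - 1 - k)) =
      (if k = n - 1 then w * x ^ k * y ^ (n - 1 - k) else 0) +
        (if k = 2 then x * x ^ k * y ^ (n - 1 - k) else 0) := by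
    intro k hk
    rw [Finset.mem_range] at hk
    have h1 : ∀ i : Fin n, (ζ ^ (i : ℕ) / n * w + (ζ ^ (i : ℕ)) ^ (n - 2) / n * x) *
        ((ζ ^ (i : ℕ) * x) ^ k * y ^ (n - 1 - k)) =
        (ζ ^ (i : ℕ)) ^ (k + 1) * (w * x ^ k * y ^ (n - 1 - k) / n) +
          (ζ ^ (i : ℕ)) ^ (k + (n - 2)) * (x * x ^ k * y ^ (n - 1 - k) / n) := by
      intro i
      rw [pow_add, pow_succ, mul_pow]
      ring
    rw [Finset.sum_congr rfl fun i _ => h1 i, Finset.sum_add_distrib, ← Finset.sum_mul,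
      ← Finset.sum_mul, sum_pow_primitiveRoot hζ, sum_pow_primitiveRoot hζ]
    have d1 : n ∣ k + 1 ↔ k = n - 1 := by
      constructor
      · intro hdvd
        have := Nat.le_of_dvd (by omega) hdvd
        omega
      · rintro rfl
        rw [Nat.sub_add_cancel (by omega)]
    have d2 : n ∣ k + (n - 2) ↔ k = 2 := by
      constructor
      · rintro ⟨m, hm⟩
        have h0 : 0 < m := by
          rcases Nat.eq_zero_or_pos m with rfl | h
          · omega
          · exact h
        have h2 : m < 2 := by
          by_contra h2
          have := Nat.mul_le_mul_left n (not_lt.1 h2)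
          omega
        obtain rfl : m = 1 := by omega
        omega
      · rintro rfl
        rw [Nat.add_sub_cancel' (by omega)]
    simp only [d1, d2]
    congr 1 <;> split_ifs
    · exact mul_div_cancel₀ _ hn0
    · exact zero_mul _
    · exact mul_div_cancel₀ _ hn0
    · exact zero_mul _
  rw [Finset.sum_congr rfl h, Finset.sum_add_distrib, Finset.sum_ite_eq', Finset.sum_ite_eq',
    if_pos (by simp; omega), if_pos (by simp; omega)]
  rw [show n - 1 - 2 = n - 3 by omega, Nat.sub_self]
  ring

end ChowForm

/-! ### Power sums and moments of signed points -/

section Moments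

/-- The power sums of two families, compared modulo an ideal: if the elementary symmetric
polynomials agree below degree `n`, then the power sums agree below degree `n` as well, and in
degree `n` their difference is given by the difference of the elementary symmetric polynomials. -/
lemma sum_pow_sub_mem {R : Type*} [CommRing R] (I : Ideal R) {d : ℕ} (l m : Fin d → R) (n : ℕ)
    (h : ∀ k < n, MvPolynomial.aeval l (MvPolynomial.esymm (Fin d) ℤ k) -
      MvPolynomial.aeval m (MvPolynomial.esymm (Fin d) ℤ k) ∈ I) :
    (∀ k < n, ∑ i, l i ^ k - ∑ i, m i ^ k ∈ I) ∧
      (0 < n → ∑ i, l i ^ n - ∑ i, m i ^ n - (-1) ^ (n + 1) * n *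
        (MvPolynomial.aeval l (MvPolynomial.esymm (Fin d) ℤ n) -
          MvPolynomial.aeval m (MvPolynomial.esymm (Fin d) ℤ n)) ∈ I) := by
  set el := fun k => MvPolynomial.aeval l (MvPolynomial.esymm (Fin d) ℤ k) with hel
  set em := fun k => MvPolynomial.aeval m (MvPolynomial.esymm (Fin d) ℤ k) with hem
  have newton : ∀ (v : Fin d → R) (k : ℕ), 0 < k → ∑ i, v i ^ k =
      (-1) ^ (k + 1) * k * MvPolynomial.aeval v (MvPolynomial.esymm (Fin d) ℤ k) -
      ∑ a ∈ Finset.HasAntidiagonal.antidiagonal k with a.1 ∈ Set.Ioo 0 k,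
        (-1) ^ a.1 * MvPolynomial.aeval v (MvPolynomial.esymm (Fin d) ℤ a.1) *
          ∑ i, v i ^ a.2 := by
    intro v k hk
    have := congrArg (MvPolynomial.aeval v)
      (MvPolynomial.psum_eq_mul_esymm_sub_sum (Fin d) ℤ k hk)
    simpa [MvPolynomial.psum, map_sum] using this
  have step : ∀ k ≤ n, 0 < k → (∀ j < k, ∑ i, l i ^ j - ∑ i, m i ^ j ∈ I) →
      ∑ i, l i ^ k - ∑ i, m i ^ k - (-1) ^ (k + 1) * k * (el k - em k) ∈ I := by
    intro k hkn hk hj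
    have : ∑ i, l i ^ k - ∑ i, m i ^ k - (-1) ^ (k + 1) * k * (el k - em k) =
        - ∑ a ∈ Finset.HasAntidiagonal.antidiagonal k with a.1 ∈ Set.Ioo 0 k,
          ((-1) ^ a.1 * (∑ i, l i ^ a.2) * (el a.1 - em a.1) +
            (-1) ^ a.1 * em a.1 * (∑ i, l i ^ a.2 - ∑ i, m i ^ a.2)) := by
      rw [newton l k hk, newton m k hk]
      have h2 : ∀ a : ℕ × ℕ, (-1) ^ a.1 * (∑ i, l i ^ a.2) * (el a.1 - em a.1) +
            (-1) ^ a.1 * em a.1 * (∑ i, l i ^ a.2 - ∑ i, m i ^ a.2) =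
          (-1) ^ a.1 * el a.1 * (∑ i, l i ^ a.2) - (-1) ^ a.1 * em a.1 * ∑ i, m i ^ a.2 :=
        fun a => by ring
      rw [Finset.sum_congr rfl fun a _ => h2 a, Finset.sum_sub_distrib]
      simp only [hel, hem]
      ring
    rw [this]
    refine I.neg_mem (I.sum_mem fun a ha => ?_)
    rw [Finset.mem_filter, Finset.HasAntidiagonal.mem_antidiagonal, Set.mem_Ioo] at ha
    exact I.add_mem (I.mul_mem_left _ (h _ (by omega))) (I.mul_mem_left _ (hj _ (by omega)))
  have hlow : ∀ k < n, ∑ i, l i ^ k - ∑ i, m i ^ k ∈ I := by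
    intro k
    induction k using Nat.strong_induction_on with
    | _ k ih =>
      intro hkn
      rcases Nat.eq_zero_or_pos k with rfl | hk
      · simp
      · have h1 := step k hkn.le hk fun j hj => ih j hj (hj.trans hkn)
        have h2 := I.add_mem h1 (I.mul_mem_left ((-1) ^ (k + 1) * (k : R)) (h k hkn))
        simpa [hel, hem] using h2
  exact ⟨hlow, fun hn => step n le_rfl hn hlow⟩

/-- Functions `u r` for which `∑ ε (u r) (u s)` vanishes unless `r = s = r₀` are linearly dependent
if there are enough of them: otherwise they would all lie in the orthogonal space of the isotropic
space spanned by the `u r` with `r ≠ r₀`, whose dimension is too small. -/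
lemma not_linearIndependent_of_isotropic {ι κ : Type*} [Fintype ι] [Fintype κ] {ε : ι → ℂ}
    (hε : ∀ t, ε t ≠ 0) (u : κ → ι → ℂ) (r₀ : κ)
    (h : ∀ r s, r ≠ r₀ → ∑ t, ε t * (u r t * u s t) = 0)
    (hcard : Fintype.card ι + 1 < 2 * Fintype.card κ) : ¬ LinearIndependent ℂ u := by
  classical
  intro hu
  let B : LinearMap.BilinForm ℂ (ι → ℂ) := Matrix.toBilin' (Matrix.diagonal ε)
  have hBapp : ∀ f g, B f g = ∑ t, ε t * (f t * g t) := by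
    intro f g
    simp only [B, Matrix.toBilin'_apply']
    rw [dotProduct]
    refine Finset.sum_congr rfl fun t _ => ?_
    rw [Matrix.mulVec_diagonal]
    ring
  have hBn : B.Nondegenerate := LinearMap.BilinForm.nondegenerate_toBilin'_of_det_ne_zero' _ (by
    rw [Matrix.det_diagonal]
    exact Finset.prod_ne_zero_iff.2 fun t _ => hε t)
  let W := Submodule.span ℂ (Set.range fun r : {r // r ≠ r₀} => u r)
  have hW : Module.finrank ℂ W = Fintype.card κ - 1 := by
    have := finrank_span_eq_card (hu.comp _ (Subtype.val_injective (p := fun r => r ≠ r₀)))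
    rw [Fintype.card_subtype_compl, Fintype.card_subtype_eq] at this
    exact this
  have hle : Submodule.span ℂ (Set.range u) ≤ B.orthogonal W := by
    rw [Submodule.span_le]
    rintro _ ⟨s, rfl⟩
    rw [SetLike.mem_coe, LinearMap.BilinForm.mem_orthogonal_iff]
    intro f hf
    change B f (u s) = 0
    have : W ≤ LinearMap.ker (B.flip (u s)) := by
      rw [Submodule.span_le]
      rintro _ ⟨r, rfl⟩
      rw [SetLike.mem_coe, LinearMap.mem_ker]
      change B (u r) (u s) = 0
      rw [hBapp]
      exact h _ _ r.2
    exact this hf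
  have h1 := Submodule.finrank_mono hle
  rw [finrank_span_eq_card hu, LinearMap.BilinForm.finrank_orthogonal hBn, hW,
    Module.finrank_fintype_fun_eq_card] at h1
  omega

open Polynomial in
/-- Signed points `(a t, b t)` of the plane with prescribed moments `∑ ε a^i b^j`: the relations
below allow a curve `p(a) b = q(a)` of low degree through all points, and such a curve is
incompatible with the two nonzero moments. -/
lemma moments_contradiction {ι : Type*} [Fintype ι] {d : ℕ} (hd : 6 ≤ d)
    (hcard : Fintype.card ι ≤ 2 * d) {ε : ι → ℂ} (hε : ∀ t, ε t ≠ 0) (a b : ι → ℂ)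
    (h0 : ∀ i j, j ≤ 2 → i + j ≤ d → ¬ (i = d ∧ j = 0) → ∑ t, ε t * (a t ^ i * b t ^ j) = 0)
    (h3 : ∀ i, i + 5 ≤ d → ∑ t, ε t * (a t ^ i * b t ^ 3) = 0)
    (hd0 : ∑ t, ε t * a t ^ d ≠ 0) (hd3 : ∑ t, ε t * (a t ^ (d - 4) * b t ^ 3) ≠ 0) : False := by
  have hpoly : ∀ (φ : ℂ[X]) (N : ℕ) (c : ι → ℂ), φ.natDegree ≤ N →
      (∀ i < N, ∑ t, ε t * (a t ^ i * c t) = 0) →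
      ∑ t, ε t * (φ.eval (a t) * c t) = φ.coeff N * ∑ t, ε t * (a t ^ N * c t) := by
    intro φ N c hφ hN
    have h1 : ∀ t, ε t * (φ.eval (a t) * c t) =
        ∑ i ∈ Finset.range (N + 1), φ.coeff i * (ε t * (a t ^ i * c t)) := by
      intro t
      rw [eval_eq_sum_range' (Nat.lt_succ_of_le hφ), Finset.sum_mul, Finset.mul_sum]
      exact Finset.sum_congr rfl fun i _ => by ring
    rw [Finset.sum_congr rfl fun t _ => h1 t, Finset.sum_comm, Finset.sum_range_succ,
      Finset.sum_eq_zero fun i hi => ?_, zero_add, ← Finset.mul_sum]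
    rw [← Finset.mul_sum, hN i (Finset.mem_range.1 hi), mul_zero]
  obtain ⟨p, q, hpq, hp, hq, hab⟩ : ∃ p q : ℂ[X], (p ≠ 0 ∨ q ≠ 0) ∧ p.natDegree ≤ (d - 1) / 2 ∧
      q.natDegree ≤ d / 2 ∧ ∀ t, p.eval (a t) * b t = q.eval (a t) := by
    let u : Fin (d / 2 + 1) ⊕ Fin ((d - 1) / 2 + 1) → ι → ℂ :=
      Sum.elim (fun i t => a t ^ (i : ℕ)) (fun i t => a t ^ (i : ℕ) * b t)
    -- the function of the largest weight, `a^{d/2}` or `a^{(d-1)/2} b`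
    let r₀ : Fin (d / 2 + 1) ⊕ Fin ((d - 1) / 2 + 1) :=
      if d % 2 = 0 then Sum.inl (Fin.last _) else Sum.inr (Fin.last _)
    have hdep : ¬ LinearIndependent ℂ u := by
      refine not_linearIndependent_of_isotropic hε u r₀ ?_ (by simp; omega)
      have hmom : ∀ r s, r ≠ r₀ → ∃ i j, j ≤ 2 ∧ i + j ≤ d ∧ ¬ (i = d ∧ j = 0) ∧
          ∀ t, u r t * u s t = a t ^ i * b t ^ j := by
        rintro (r | r) (s | s) hr
        · refine ⟨r + s, 0, by omega, by omega, ?_, fun t => by simp [u]; ring⟩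
          rintro ⟨h, -⟩
          have hd2 : d % 2 = 0 := by omega
          refine hr ?_
          simp only [r₀, if_pos hd2]
          congr 1
          ext
          simp
          omega
        · exact ⟨r + s, 1, by omega, by omega, by omega, fun t => by simp [u]; ring⟩
        · exact ⟨r + s, 1, by omega, by omega, by omega, fun t => by simp [u]; ring⟩
        · refine ⟨r + s, 2, by omega, ?_, by omega, fun t => by simp [u]; ring⟩
          by_contra h
          have hd2 : ¬ d % 2 = 0 := by omega
          refine hr ?_
          simp only [r₀, if_neg hd2]
          congr 1
          ext
          simp
          omega
      intro r s hr
      obtain ⟨i, j, hj, hij, hne, hrs⟩ := hmom r s hr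
      simp only [hrs]
      exact h0 i j hj hij hne
    rw [Fintype.not_linearIndependent_iff] at hdep
    obtain ⟨g, hg, r, hr⟩ := hdep
    have hcoeff : ∀ {N : ℕ} (f : Fin (N + 1) → ℂ) (i : Fin (N + 1)),
        (∑ j, C (f j) * X ^ (j : ℕ)).coeff i = f i := by
      intro N f i
      rw [finsetSum_coeff, Finset.sum_eq_single i]
      · simp
      · intro j _ hj
        rw [coeff_C_mul_X_pow, if_neg fun h => hj (Fin.ext h.symm)]
      · simp
    have hdeg : ∀ {N : ℕ} (f : Fin (N + 1) → ℂ),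
        (∑ j, C (f j) * X ^ (j : ℕ)).natDegree ≤ N := fun f =>
      natDegree_sum_le_of_forall_le _ _ fun j _ => (natDegree_C_mul_X_pow_le _ _).trans (by omega)
    refine ⟨-∑ j, C (g (Sum.inr j)) * X ^ (j : ℕ), ∑ j, C (g (Sum.inl j)) * X ^ (j : ℕ), ?_, ?_,
      hdeg _, fun t => ?_⟩
    · rcases r with r | r
      · right
        intro h
        refine hr ?_
        rw [← hcoeff (fun j => g (Sum.inl j)) r, h, coeff_zero]
      · left
        intro h
        refine hr ?_
        rw [← hcoeff (fun j => g (Sum.inr j)) r, neg_eq_zero.1 h, coeff_zero]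
    · rw [natDegree_neg]
      exact hdeg _
    · have h1 := congrFun hg t
      simp only [Fintype.sum_sum_type, u, Finset.sum_apply, Pi.smul_apply, smul_eq_mul,
        Sum.elim_inl, Sum.elim_inr, Pi.zero_apply] at h1
      simp only [eval_neg, eval_finsetSum, eval_mul, eval_C, eval_pow, eval_X]
      rw [neg_mul, Finset.sum_mul, neg_eq_iff_add_eq_zero, add_comm, ← h1]
      congr 1
      exact Finset.sum_congr rfl fun i _ => by ring
  -- if `q` had the larger degree, then `a^{d - deg q} q` would have a nonzero moment
  have hcase : p ≠ 0 ∧ q.natDegree ≤ p.natDegree := by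
    by_contra hcon
    have hq0 : q ≠ 0 := by
      rintro rfl
      simp at hcon hpq
      exact hpq hcon
    have hlt : (X ^ (d - q.natDegree) * p).natDegree + 1 ≤ d := by
      by_cases hp0 : p = 0
      · simp [hp0]
        omega
      · have : p.natDegree < q.natDegree := by
          by_contra h
          exact hcon ⟨hp0, by omega⟩
        rw [natDegree_mul (pow_ne_zero _ X_ne_zero) hp0, natDegree_X_pow]
        omega
    have h1 := hpoly (X ^ (d - q.natDegree) * q) d (fun _ => 1)
      (by rw [natDegree_mul (pow_ne_zero _ X_ne_zero) hq0, natDegree_X_pow]; omega)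
      fun i hi => by simpa using h0 i 0 (by omega) (by omega) (by omega)
    have h2 := hpoly (X ^ (d - q.natDegree) * p) (d - 1) b (by omega)
      fun i hi => by simpa using h0 i 1 (by omega) (by omega) (by omega)
    have h2' := h0 (d - 1) 1 (by omega) (by omega) (by omega)
    simp only [pow_one] at h2'
    rw [h2', mul_zero] at h2
    have h4 : (X ^ (d - q.natDegree) * q).coeff d = q.leadingCoeff := by
      conv_lhs => rw [show d = q.natDegree + (d - q.natDegree) by omega, mul_comm]
      rw [show q.natDegree + (d - q.natDegree) - q.natDegree = d - q.natDegree by omega,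
        coeff_mul_X_pow, leadingCoeff]
    rw [h4] at h1
    refine mul_ne_zero (leadingCoeff_ne_zero.2 hq0) hd0 ?_
    simp only [mul_one] at h1
    rw [← h1, ← h2]
    refine Finset.sum_congr rfl fun t _ => ?_
    rw [eval_mul, eval_mul, mul_assoc, hab]
  -- if `p` has the larger degree, then `a^{d - 4 - deg p} p b³` has a nonzero moment
  obtain ⟨hp0, hle⟩ := hcase
  have hN : p.natDegree ≤ d - 4 := by omega
  have hX : ∀ f : ℂ[X], f.natDegree ≤ p.natDegree →
      (X ^ (d - 4 - p.natDegree) * f).natDegree ≤ d - 4 := fun f hf =>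
    natDegree_mul_le.trans (by rw [natDegree_X_pow]; omega)
  have h1 := hpoly (X ^ (d - 4 - p.natDegree) * p) (d - 4) (fun t => b t ^ 3) (hX p le_rfl)
    fun i hi => h3 i (by omega)
  have h2 := hpoly (X ^ (d - 4 - p.natDegree) * q) (d - 4) (fun t => b t ^ 2) (hX q hle)
    fun i hi => h0 i 2 (by omega) (by omega) (by omega)
  rw [h0 (d - 4) 2 (by omega) (by omega) (by omega), mul_zero] at h2
  have h4 : (X ^ (d - 4 - p.natDegree) * p).coeff (d - 4) = p.leadingCoeff := by
    conv_lhs => rw [show d - 4 = p.natDegree + (d - 4 - p.natDegree) by omega, mul_comm]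
    rw [show p.natDegree + (d - 4 - p.natDegree) - p.natDegree = d - 4 - p.natDegree by omega,
      coeff_mul_X_pow, leadingCoeff]
  rw [h4] at h1
  refine mul_ne_zero (leadingCoeff_ne_zero.2 hp0) hd3 ?_
  rw [← h1, ← h2]
  refine Finset.sum_congr rfl fun t _ => ?_
  rw [eval_mul, eval_mul]
  linear_combination (ε t * eval (a t) (X ^ (d - 4 - p.natDegree)) * b t ^ 2) * hab t

end Moments

/-! ### Chow varieties in dimension three -/

section ChowDimThree

open Polynomial in
lemma coeff_linear_pow (a b : ℂ) (i j : ℕ) :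
    ((C a + C b * X) ^ (i + j)).coeff j = (i + j).choose j * (a ^ i * b ^ j) := by
  rw [add_comm (C a), add_pow, finsetSum_coeff, Finset.sum_eq_single j]
  · rw [mul_pow, Nat.add_sub_cancel, ← C_pow, ← C_pow,
      show C (b ^ j) * X ^ j * C (a ^ i) * ((i + j).choose j : ℂ[X]) =
        C (b ^ j * a ^ i * ((i + j).choose j : ℂ)) * X ^ j by
          simp only [map_mul, map_natCast]; ring,
      coeff_C_mul_X_pow, if_pos rfl]
    ring
  · intro m _ hm
    rw [mul_pow, ← C_pow, ← C_pow,
      show C (b ^ m) * X ^ m * C (a ^ (i + j - m)) * ((i + j).choose m : ℂ[X]) =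
        C (b ^ m * a ^ (i + j - m) * ((i + j).choose m : ℂ)) * X ^ m by
          simp only [map_mul, map_natCast]; ring,
      coeff_C_mul_X_pow, if_neg hm.symm]
  · intro h
    simp at h

lemma coeff_prod_X_sub_C {R : Type*} [CommRing R] {d : ℕ} (l : Fin d → R) {k : ℕ} (hk : k ≤ d) :
    (∏ i, (Polynomial.X - Polynomial.C (l i))).coeff (d - k) =
      (-1) ^ k * MvPolynomial.aeval l (MvPolynomial.esymm (Fin d) ℤ k) := by
  have h := Multiset.prod_X_sub_C_coeff (Finset.univ.val.map l) (k := d - k) (by simp)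
  rw [Multiset.map_map, Multiset.card_map, Finset.card_val, Finset.card_univ, Fintype.card_fin,
    Nat.sub_sub_self hk] at h
  rw [MvPolynomial.aeval_esymm_eq_multiset_esymm]
  exact h

open Polynomial in
/-- The case where all linear forms involve `w`. Setting `y = 1`, both products become polynomials
in `w` with roots `a + b x`; Newton's identities turn the coefficients, modulo powers of `x`, into
the moments of the points `(a, b)`, taken with signs. -/
lemma ternary_form_ne_of_forall_ne_zero {d : ℕ} (hd : 6 ≤ d) {α β γ α' β' γ' : Fin d → ℂ}
    (h : ∀ w x y : ℂ, w ^ 2 * x ^ (d - 2) + w * x ^ 3 * y ^ (d - 4) + y ^ d - y * x ^ (d - 1) =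
      ∏ i, (w * α i + x * β i + y * γ i) + ∏ i, (w * α' i + x * β' i + y * γ' i))
    (hα : ∀ i, α i ≠ 0) (hα' : ∀ i, α' i ≠ 0) : False := by
  set κ := ∏ i, α i with hκ
  set κ' := ∏ i, α' i with hκ'
  have hκ0 : κ ≠ 0 := Finset.prod_ne_zero_iff.2 fun i _ => hα i
  let l : Fin d → ℂ[X] := fun i => C (-γ i / α i) + C (-β i / α i) * X
  let m : Fin d → ℂ[X] := fun i => C (-γ' i / α' i) + C (-β' i / α' i) * X
  have hpoly : C (C κ) * ∏ i, (X - C (l i)) + C (C κ') * ∏ i, (X - C (m i)) =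
      C (X ^ (d - 2)) * X ^ 2 + C (X ^ 3) * X ^ 1 + C (1 - X ^ (d - 1)) * X ^ 0 := by
    refine Polynomial.funext fun r => Polynomial.funext fun x => ?_
    have h1 := h (r.eval x) x 1
    simp only [eval_add, eval_mul, eval_C, eval_prod, eval_sub, eval_X, eval_pow, l, m, hκ, hκ',
      ← Finset.prod_mul_distrib, eval_one]
    have e1 : ∀ i, α i * (r.eval x - (-γ i / α i + -β i / α i * x)) =
        r.eval x * α i + x * β i + 1 * γ i := fun i => by
      have := hα i
      field_simp
      ring
    have e2 : ∀ i, α' i * (r.eval x - (-γ' i / α' i + -β' i / α' i * x)) =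
        r.eval x * α' i + x * β' i + 1 * γ' i := fun i => by
      have := hα' i
      field_simp
      ring
    simp only [e1, e2, ← h1]
    simp
    ring
  set el := fun k => MvPolynomial.aeval l (MvPolynomial.esymm (Fin d) ℤ k) with hel
  set em := fun k => MvPolynomial.aeval m (MvPolynomial.esymm (Fin d) ℤ k) with hem
  have hcoeff : ∀ k ≤ d, C κ * ((-1) ^ k * el k) + C κ' * ((-1) ^ k * em k) =
      (if d - k = 2 then X ^ (d - 2) else 0) + (if d - k = 1 then X ^ 3 else 0) +
        (if d - k = 0 then 1 - X ^ (d - 1) else 0) := by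
    intro k hk
    have h1 := congrArg (fun f => Polynomial.coeff f (d - k)) hpoly
    simp only [coeff_add, coeff_C_mul, coeff_prod_X_sub_C _ hk, coeff_X_pow, mul_ite, mul_one,
      mul_zero] at h1
    exact h1
  have hsum : C κ' = -C κ := by
    have h1 := hcoeff 0 (Nat.zero_le d)
    rw [if_neg (by omega), if_neg (by omega), if_neg (by omega)] at h1
    simp [hel, hem, MvPolynomial.esymm_zero] at h1
    linear_combination h1
  have hdiff : ∀ k ≤ d, el k - em k = C κ⁻¹ * (-1) ^ k *
      ((if d - k = 2 then X ^ (d - 2) else 0) + (if d - k = 1 then X ^ 3 else 0) +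
        (if d - k = 0 then 1 - X ^ (d - 1) else 0)) := by
    intro k hk
    rw [← hcoeff k hk, hsum]
    have h1 : C κ⁻¹ * C κ = 1 := by rw [← C_mul, inv_mul_cancel₀ hκ0, C_1]
    have h2 : ((-1 : ℂ[X]) ^ k) * (-1) ^ k = 1 := by rw [← mul_pow]; simp
    linear_combination (-(el k - em k) * (-1) ^ k * (-1) ^ k) * h1 - (el k - em k) * h2
  -- modulo `x⁴` up to degree `d - 1`, and modulo `x³` up to degree `d`
  obtain ⟨hlow, htop⟩ := sum_pow_sub_mem (Ideal.span {(X : ℂ[X]) ^ 4}) l m (d - 1) (by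
    intro k hk
    change el k - em k ∈ _
    rw [hdiff k (by omega), if_neg (by omega : ¬ d - k = 1), if_neg (by omega : ¬ d - k = 0)]
    refine Ideal.mul_mem_left _ _ ?_
    rw [Ideal.mem_span_singleton, add_zero, add_zero]
    split_ifs
    · exact pow_dvd_pow _ (by omega)
    · exact dvd_zero _)
  obtain ⟨hlow3, htop3⟩ := sum_pow_sub_mem (Ideal.span {(X : ℂ[X]) ^ 3}) l m d (by
    intro k hk
    change el k - em k ∈ _
    rw [hdiff k (by omega), if_neg (by omega : ¬ d - k = 0)]
    refine Ideal.mul_mem_left _ _ ?_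
    rw [Ideal.mem_span_singleton, add_zero]
    refine dvd_add ?_ ?_
    · split_ifs
      · exact pow_dvd_pow _ (by omega)
      · exact dvd_zero _
    · split_ifs
      · exact dvd_rfl
      · exact dvd_zero _)
  replace htop := htop (by omega)
  replace htop3 := htop3 (by omega)
  change _ - _ * (el (d - 1) - em (d - 1)) ∈ _ at htop
  change _ - _ * (el d - em d) ∈ _ at htop3
  rw [hdiff _ (by omega), if_neg (by omega : ¬ d - (d - 1) = 2),
    if_neg (by omega : ¬ d - (d - 1) = 0), if_pos (by omega : d - (d - 1) = 1), zero_add, add_zero,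
    Ideal.mem_span_singleton, X_pow_dvd_iff] at htop
  rw [hdiff _ le_rfl, if_neg (by omega : ¬ d - d = 2), if_neg (by omega : ¬ d - d = 1),
    if_pos (by omega : d - d = 0), zero_add, zero_add, Ideal.mem_span_singleton,
    X_pow_dvd_iff] at htop3
  simp only [Ideal.mem_span_singleton, X_pow_dvd_iff] at hlow
  -- the moments are the coefficients of the power sums
  let ε : Fin d ⊕ Fin d → ℂ := Sum.elim (fun _ => 1) (fun _ => -1)
  let a : Fin d ⊕ Fin d → ℂ := Sum.elim (fun i => -γ i / α i) (fun i => -γ' i / α' i)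
  let b : Fin d ⊕ Fin d → ℂ := Sum.elim (fun i => -β i / α i) (fun i => -β' i / α' i)
  have hmom : ∀ i j k, i + j = k → (∑ i, l i ^ k - ∑ i, m i ^ k).coeff j =
      k.choose j * ∑ t, ε t * (a t ^ i * b t ^ j) := by
    rintro i j _ rfl
    rw [coeff_sub, finsetSum_coeff, finsetSum_coeff, Fintype.sum_sum_type, mul_add]
    simp only [l, m, coeff_linear_pow, ε, a, b, Sum.elim_inl, Sum.elim_inr, Finset.mul_sum, one_mul,
      neg_mul, mul_neg, Finset.sum_neg_distrib, ← sub_eq_add_neg]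
  have hchoose : ∀ i j : ℕ, ((i + j).choose j : ℂ) ≠ 0 := fun i j =>
    Nat.cast_ne_zero.2 (Nat.choose_pos (Nat.le_add_left j i)).ne'
  have hzero : ∀ i j, (∑ r, l r ^ (i + j) - ∑ r, m r ^ (i + j)).coeff j = 0 →
      ∑ t, ε t * (a t ^ i * b t ^ j) = 0 := fun i j hij => by
    rw [hmom i j _ rfl] at hij
    exact (mul_eq_zero.1 hij).resolve_left (hchoose i j)
  have ht1 : ∀ j < 4, (∑ i, l i ^ (d - 1) - ∑ i, m i ^ (d - 1)).coeff j =
      (-1) ^ (d - 1 + 1) * ((d - 1 : ℕ) : ℂ) * (κ⁻¹ * (-1) ^ (d - 1)) * if j = 3 then 1 else 0 := by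
    intro j hj
    have h1 := htop j hj
    rw [coeff_sub, sub_eq_zero] at h1
    rw [h1, show (-1 : ℂ[X]) ^ (d - 1 + 1) * ((d - 1 : ℕ) : ℂ[X]) *
      (C κ⁻¹ * (-1) ^ (d - 1) * X ^ 3) =
      C ((-1) ^ (d - 1 + 1) * ((d - 1 : ℕ) : ℂ) * (κ⁻¹ * (-1) ^ (d - 1))) * X ^ 3 by
        simp only [map_mul, map_pow, map_neg, map_one, map_natCast]; ring, coeff_C_mul, coeff_X_pow]
  have ht2 : ∀ j < 3, (∑ i, l i ^ d - ∑ i, m i ^ d).coeff j =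
      (-1) ^ (d + 1) * (d : ℂ) * (κ⁻¹ * (-1) ^ d) * if j = 0 then 1 else 0 := by
    intro j hj
    have h1 := htop3 j hj
    rw [coeff_sub, sub_eq_zero] at h1
    rw [h1, show (-1 : ℂ[X]) ^ (d + 1) * (d : ℂ[X]) * (C κ⁻¹ * (-1) ^ d * (1 - X ^ (d - 1))) =
      C ((-1) ^ (d + 1) * (d : ℂ) * (κ⁻¹ * (-1) ^ d)) * (1 - X ^ (d - 1)) by
        simp only [map_mul, map_pow, map_neg, map_one, map_natCast]; ring, coeff_C_mul, coeff_sub,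
      coeff_one, coeff_X_pow, if_neg (by omega : ¬ j = d - 1), sub_zero]
  refine moments_contradiction hd (by simp; omega) (ε := ε) (a := a) (b := b) ?_ ?_ ?_ ?_ ?_
  · rintro (t | t) <;> simp [ε]
  · intro i j hj hij hne
    refine hzero i j ?_
    rcases (by omega : i + j < d - 1 ∨ i + j = d - 1 ∨ i + j = d) with h1 | h1 | h1
    · exact hlow _ h1 j (by omega)
    · rw [h1, ht1 j (by omega), if_neg (by omega), mul_zero]
    · rw [h1, ht2 j (by omega), if_neg (by omega), mul_zero]
  · intro i hi
    exact hzero i 3 (hlow _ (by omega) 3 (by omega))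
  · intro h1
    have h2 := ht2 0 (by omega)
    rw [hmom d 0 d (by omega)] at h2
    simp only [pow_zero, mul_one, h1, mul_zero, if_true] at h2
    refine mul_ne_zero (mul_ne_zero (by simp) ?_) (mul_ne_zero (inv_ne_zero hκ0) (by simp)) h2.symm
    exact_mod_cast (by omega : d ≠ 0)
  · intro h1
    have h2 := ht1 3 (by omega)
    rw [hmom (d - 4) 3 (d - 1) (by omega), h1, mul_zero] at h2
    simp only [if_true, mul_one] at h2
    refine mul_ne_zero (mul_ne_zero (by simp) ?_) (mul_ne_zero (inv_ne_zero hκ0) (by simp)) h2.symm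
    exact_mod_cast (by omega : d - 1 ≠ 0)

open Polynomial in
/-- If one of the forms `L i` does not involve `w`, then at most two of the `M j` do: on the line
`L i = 0` the product of the `M j` is a nonzero polynomial of degree at most two in `w`. -/
lemma ternary_form_coeff_eq_zero {d : ℕ} (hd : 6 ≤ d) {α β γ α' β' γ' : Fin d → ℂ}
    (h : ∀ w x y : ℂ, w ^ 2 * x ^ (d - 2) + w * x ^ 3 * y ^ (d - 4) + y ^ d - y * x ^ (d - 1) =
      ∏ i, (w * α i + x * β i + y * γ i) + ∏ i, (w * α' i + x * β' i + y * γ' i))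
    {i : Fin d} (hi : α i = 0) : ∃ j k, j ≠ k ∧ ∀ r, r ≠ j → r ≠ k → α' r = 0 := by
  obtain ⟨x, y, hL, hxy⟩ : ∃ x y : ℂ, x * β i + y * γ i = 0 ∧ (x = 1 ∨ x = 0 ∧ y = 1) := by
    by_cases hγ : γ i = 0
    · exact ⟨0, 1, by rw [hγ]; ring, Or.inr ⟨rfl, rfl⟩⟩
    · exact ⟨1, -β i / γ i, by field_simp; ring, Or.inl rfl⟩
  set f : ℂ[X] := ∏ j, (C (α' j) * X + C (x * β' j + y * γ' j)) with hf
  have hfeq : f = C (x ^ (d - 2)) * X ^ 2 + C (x ^ 3 * y ^ (d - 4)) * X +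
      C (y ^ d - y * x ^ (d - 1)) := by
    refine Polynomial.funext fun w => ?_
    have h1 := h w x y
    rw [Finset.prod_eq_zero (Finset.mem_univ i) (by rw [hi]; linear_combination hL), zero_add] at h1
    simp only [hf, eval_prod, eval_add, eval_mul, eval_C, eval_X, eval_pow]
    rw [Finset.prod_congr rfl fun j _ => show α' j * w + (x * β' j + y * γ' j) =
      w * α' j + x * β' j + y * γ' j by ring, ← h1]
    ring
  have hf0 : f ≠ 0 := by
    intro h0
    rcases hxy with rfl | ⟨rfl, rfl⟩
    · have h1 := congrArg (fun g => coeff g 2) (hfeq.symm.trans h0)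
      simp only [coeff_add, coeff_C_mul, coeff_X_pow, coeff_X, coeff_C] at h1
      simp at h1
    · have h1 := congrArg (eval 0) (hfeq.symm.trans h0)
      simp [show d - 1 ≠ 0 by omega] at h1
  have hdeg : f.natDegree ≤ 2 := by
    rw [hfeq]
    exact natDegree_quadratic_le
  have hcard : (Finset.univ.filter fun j => α' j ≠ 0).card ≤ 2 := by
    refine le_trans (le_of_eq ?_) hdeg
    rw [hf, natDegree_prod _ _ (Finset.prod_ne_zero_iff.1 hf0), Finset.card_filter]
    refine Finset.sum_congr rfl fun j _ => ?_
    by_cases hj : α' j = 0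
    · rw [if_neg (not_not.2 hj), hj, C_0, zero_mul, zero_add, natDegree_C]
    · rw [if_pos hj, natDegree_linear hj]
  obtain ⟨t, hst, -, ht⟩ := Finset.exists_subsuperset_card_eq
    (Finset.filter_subset (fun j => α' j ≠ 0) Finset.univ) hcard (by simp; omega)
  obtain ⟨j, k, hjk, rfl⟩ := Finset.card_eq_two.1 ht
  refine ⟨j, k, hjk, fun r hrj hrk => ?_⟩
  by_contra hr
  have := hst (Finset.mem_filter.2 ⟨Finset.mem_univ r, hr⟩)
  simp [hrj, hrk] at this

open Polynomial in
/-- The case where at most two linear forms of each product involve `w`. At `x = 1` the products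
are `p (a w² + s w + u)` and `q (a' w² + s' w + u')`. Eliminating `q` from the coefficients of `w²`
and `w` bounds the degree of `p` by `d - 4`, and eliminating it from those of `w²` and `1` shows
that this is too small. -/
lemma quadratic_pencil_false {d : ℕ} (hd : 6 ≤ d) {p q s u s' u' : ℂ[X]} {a a' : ℂ} (ha' : a' ≠ 0)
    (hu : u.natDegree ≤ 2) (hs' : s'.natDegree ≤ 1) (hu' : u'.natDegree ≤ 2)
    (h2 : p * C a + q * C a' = 1) (h1 : p * s + q * s' = X ^ (d - 4))
    (h0 : p * u + q * u' = X ^ d - X) : False := by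
  have e1 : p * (C a' * s - C a * s') = C a' * X ^ (d - 4) - s' := by
    linear_combination C a' * h1 - s' * h2
  have e0 : p * (C a' * u - C a * u') = C a' * X ^ d - (C a' * X + u') := by
    linear_combination C a' * h0 - u' * h2
  have d1 : (C a' * X ^ (d - 4) - s').natDegree = d - 4 := by
    rw [natDegree_sub_eq_left_of_natDegree_lt, natDegree_C_mul_X_pow _ _ ha']
    rw [natDegree_C_mul_X_pow _ _ ha']
    omega
  have d0 : (C a' * X ^ d - (C a' * X + u')).natDegree = d := by
    rw [natDegree_sub_eq_left_of_natDegree_lt, natDegree_C_mul_X_pow _ _ ha']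
    rw [natDegree_C_mul_X_pow _ _ ha']
    have := natDegree_add_le_of_degree_le
      (((natDegree_C_mul_le a' X).trans natDegree_X_le).trans one_le_two) hu'
    omega
  have hp : p.natDegree ≤ d - 4 := by
    rw [← d1]
    refine natDegree_le_of_dvd (Dvd.intro _ e1) fun h => ?_
    rw [h, natDegree_zero] at d1
    omega
  have hq : (C a' * u - C a * u').natDegree ≤ 2 :=
    natDegree_sub_le_of_le ((natDegree_C_mul_le _ _).trans hu) ((natDegree_C_mul_le _ _).trans hu')
  rw [← e0] at d0
  have := natDegree_mul_le (p := p) (q := C a' * u - C a * u')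
  omega

open Polynomial in
/-- The form `w² x^{d-2} + w x³ y^{d-4} + y^d - y x^{d-1}` is not a sum of two products of linear
forms. -/
lemma ternary_form_ne {d : ℕ} (hd : 6 ≤ d) {α β γ α' β' γ' : Fin d → ℂ}
    (h : ∀ w x y : ℂ, w ^ 2 * x ^ (d - 2) + w * x ^ 3 * y ^ (d - 4) + y ^ d - y * x ^ (d - 1) =
      ∏ i, (w * α i + x * β i + y * γ i) + ∏ i, (w * α' i + x * β' i + y * γ' i)) : False := by
  have hsymm := fun w x y => (h w x y).trans (add_comm _ _)
  have hex : ∀ j k : Fin d, ∃ r, r ≠ j ∧ r ≠ k := fun j k => by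
    have : ({j, k} : Finset (Fin d)).card < (Finset.univ : Finset (Fin d)).card :=
      (Finset.card_le_two).trans_lt (by simp; omega)
    obtain ⟨r, -, hr⟩ := Finset.exists_mem_notMem_of_card_lt_card this
    exact ⟨r, by simpa using hr⟩
  have hpair : (∃ j k, j ≠ k ∧ ∀ r, r ≠ j → r ≠ k → α r = 0) ∧
      ∃ j k, j ≠ k ∧ ∀ r, r ≠ j → r ≠ k → α' r = 0 := by
    by_cases hα : ∀ i, α i ≠ 0
    · by_cases hα' : ∀ i, α' i ≠ 0
      · exact (ternary_form_ne_of_forall_ne_zero hd h hα hα').elim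
      · push Not at hα'
        obtain ⟨i, hi⟩ := hα'
        obtain ⟨j, k, hjk, h1⟩ := ternary_form_coeff_eq_zero hd hsymm hi
        obtain ⟨r, hrj, hrk⟩ := hex j k
        exact (hα r (h1 r hrj hrk)).elim
    · push Not at hα
      obtain ⟨i, hi⟩ := hα
      obtain ⟨j, k, hjk, h1⟩ := ternary_form_coeff_eq_zero hd h hi
      obtain ⟨r, hrj, hrk⟩ := hex j k
      exact ⟨ternary_form_coeff_eq_zero hd hsymm (h1 r hrj hrk), j, k, hjk, h1⟩
  -- at `x = 1`, a product in which at most two factors involve `w`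
  have hfactor : ∀ {α β γ : Fin d → ℂ}, (∃ j k, j ≠ k ∧ ∀ r, r ≠ j → r ≠ k → α r = 0) →
      ∃ (p s u : ℂ[X]) (a : ℂ), s.natDegree ≤ 1 ∧ u.natDegree ≤ 2 ∧ ∀ w y : ℂ,
        ∏ i, (w * α i + 1 * β i + y * γ i) =
          p.eval y * (a * w ^ 2 + s.eval y * w + u.eval y) := by
    rintro α β γ ⟨j, k, hjk, h1⟩
    let l : Fin d → ℂ[X] := fun i => C (γ i) * X + C (β i)
    refine ⟨∏ i ∈ (Finset.univ.erase j).erase k, l i, C (α j) * l k + C (α k) * l j, l j * l k,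
      α j * α k, ?_, ?_, fun w y => ?_⟩
    · exact natDegree_add_le_of_degree_le ((natDegree_C_mul_le _ _).trans natDegree_linear_le)
        ((natDegree_C_mul_le _ _).trans natDegree_linear_le)
    · exact natDegree_mul_le.trans (add_le_add natDegree_linear_le natDegree_linear_le)
    · rw [← Finset.mul_prod_erase Finset.univ _ (Finset.mem_univ j),
        ← Finset.mul_prod_erase (Finset.univ.erase j) _
          (Finset.mem_erase.2 ⟨hjk.symm, Finset.mem_univ k⟩)]
      have h2 : ∏ i ∈ (Finset.univ.erase j).erase k, (w * α i + 1 * β i + y * γ i) =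
          ∏ i ∈ (Finset.univ.erase j).erase k, (l i).eval y := by
        refine Finset.prod_congr rfl fun i hi => ?_
        simp only [Finset.mem_erase] at hi
        rw [h1 i hi.2.1 hi.1]
        simp [l]
        ring
      rw [h2, eval_prod]
      simp only [l, eval_add, eval_mul, eval_C, eval_X]
      ring
  obtain ⟨p, s, u, a, hs, hu, hp⟩ := hfactor (β := β) (γ := γ) hpair.1
  obtain ⟨q, s', u', a', hs', hu', hq⟩ := hfactor (β := β') (γ := γ') hpair.2
  have key : ∀ w y : ℂ, w ^ 2 + w * y ^ (d - 4) + y ^ d - y =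
      p.eval y * (a * w ^ 2 + s.eval y * w + u.eval y) +
        q.eval y * (a' * w ^ 2 + s'.eval y * w + u'.eval y) := by
    intro w y
    rw [← hp, ← hq, ← h]
    simp
  -- the coefficients of `w²`, `w` and `1`, from the values at `w = 0, 1, -1`
  have h2 : p * C a + q * C a' = 1 := Polynomial.funext fun y => by
    simp only [eval_add, eval_mul, eval_C, eval_one]
    linear_combination key 0 y - (key 1 y + key (-1) y) / 2
  have h1 : p * s + q * s' = X ^ (d - 4) := Polynomial.funext fun y => by
    simp only [eval_add, eval_mul, eval_pow, eval_X]
    linear_combination (key (-1) y - key 1 y) / 2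
  have h0 : p * u + q * u' = X ^ d - X := Polynomial.funext fun y => by
    simp only [eval_add, eval_sub, eval_mul, eval_pow, eval_X]
    linear_combination -key 0 y
  by_cases ha' : a' = 0
  · by_cases ha : a = 0
    · simp [ha, ha'] at h2
    · exact quadratic_pencil_false hd ha hu' hs hu ((add_comm _ _).trans h2)
        ((add_comm _ _).trans h1) ((add_comm _ _).trans h0)
  · exact quadratic_pencil_false hd ha' hu hs' hu' h2 h1 h0

variable {V : Type*} [AddCommGroup V] [Module ℂ V] [FiniteDimensional ℂ V]

/-- In dimension at least three and degree `d = n + 1 ≥ 6`: the tangent vector is the form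
`w² x^{d-2} + w x³ y^{d-4} + y^d - y x^{d-1}`. The point `w (yⁿ - xⁿ)` of the cone is a product of
distinct linear forms, so that the factors can be moved independently. -/
lemma bestApproxFails_chow_of_three_le {d : ℕ} (hd : 6 ≤ d)
    (c : InnerProductSpace.Core ℂ (⨂[ℂ] _ : Fin d, V)) (hV : 3 ≤ Module.finrank ℂ V)
    (hg : 2 < genericRank c (chow V d)) : BestApproxFails c (chow V d) := by
  obtain ⟨n, rfl⟩ := Nat.exists_eq_add_of_le' (show 1 ≤ d by omega)
  obtain ⟨e, δ, hδ⟩ := exists_linearIndependent_fin hV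
  have hn0 : n ≠ 0 := by omega
  have hζ := Complex.isPrimitiveRoot_exp n hn0
  set ζ := Complex.exp (2 * Real.pi * Complex.I / n)
  refine bestApproxFails_chow_of (by omega) c hg
    (Fin.cons (e 0) fun i : Fin n => e 2 - ζ ^ (i : ℕ) • e 1)
    (Fin.cons (e 2) fun i : Fin n =>
      (ζ ^ (i : ℕ) / n) • e 0 + ((ζ ^ (i : ℕ)) ^ (n - 2) / n) • e 1) fun P hP u u' hu => ?_
  refine ternary_form_ne hd (α := fun i => δ 0 (u i)) (β := fun i => δ 1 (u i))
    (γ := fun i => δ 2 (u i)) (α' := fun i => δ 0 (u' i)) (β' := fun i => δ 1 (u' i))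
    (γ' := fun i => δ 2 (u' i)) fun w x y => ?_
  set ξ := w • δ 0 + x • δ 1 + y • δ 2 with hξ
  have h0 : ξ (e 0) = w := by simp [hξ, hδ]
  have h1 : ξ (e 1) = x := by simp [hξ, hδ]
  have h2 : ξ (e 2) = y := by simp [hξ, hδ]
  have h4 := hu ξ
  have hprod : ∏ i : Fin n, (y - ζ ^ (i : ℕ) * x) = y ^ n - x ^ n :=
    (sub_pow_eq_prod_primitiveRoot hζ hn0 x y).symm
  rw [hP, sum_mul_prod_erase_succ] at h4
  simp only [Fin.cons_zero, Fin.cons_succ, map_add, map_sub, map_smul, h0, h1, h2, smul_eq_mul,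
    hprod] at h4
  rw [sum_mul_prod_erase_primitiveRoot (by omega) hζ] at h4
  simp only [hξ, LinearMap.add_apply, LinearMap.smul_apply, smul_eq_mul] at h4
  rw [← h4]
  simp only [show n + 1 - 2 = n - 1 by omega, show n + 1 - 4 = n - 3 by omega, Nat.add_sub_cancel]
  ring

lemma bestApproxFails_chow {d : ℕ} (c : InnerProductSpace.Core ℂ (⨂[ℂ] _ : Fin d, V)) (hd : 3 ≤ d)
    (h3 : Module.finrank ℂ V = 3 → 6 ≤ d) (hg : 2 < genericRank c (chow V d)) :
    BestApproxFails c (chow V d) := by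
  rcases (by omega : Module.finrank ℂ V ≤ 2 ∨ Module.finrank ℂ V = 3 ∨ 4 ≤ Module.finrank ℂ V)
    with h | h | h
  · have := hg.trans_le (genericRank_chow_le_one (by omega) c h)
    exact absurd this (by norm_num)
  · exact bestApproxFails_chow_of_three_le (h3 h) c h.ge hg
  · exact bestApproxFails_chow_of_four_le hd c h hg

end ChowDimThree

end XRank

end

theorem theorem6p3 :
    -- Segre
    (∀ (d : ℕ) (V : Fin d → Type u) [∀ i, AddCommGroup (V i)] [∀ i, Module ℂ (V i)]
      [∀ i, FiniteDimensional ℂ (V i)] (c : InnerProductSpace.Core ℂ (⨂[ℂ] i, V i)),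
      3 ≤ d → (∀ i, 2 ≤ Module.finrank ℂ (V i)) →
      2 < XRank.genericRank c (XRank.segre V) →
      XRank.BestApproxFails c (XRank.segre V)) ∧
    -- Veronese
    (∀ (d : ℕ) (V : Type u) [AddCommGroup V] [Module ℂ V] [FiniteDimensional ℂ V]
      (c : InnerProductSpace.Core ℂ (⨂[ℂ] _ : Fin d, V)),
      3 ≤ d →
      2 < XRank.genericRank c (XRank.veronese V d) →
      XRank.BestApproxFails c (XRank.veronese V d)) ∧
    -- Chow
    (∀ (d : ℕ) (V : Type u) [AddCommGroup V] [Module ℂ V] [FiniteDimensional ℂ V]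
      (c : InnerProductSpace.Core ℂ (⨂[ℂ] _ : Fin d, V)),
      3 ≤ d → (Module.finrank ℂ V = 3 → 6 ≤ d) →
      2 < XRank.genericRank c (XRank.chow V d) →
      XRank.BestApproxFails c (XRank.chow V d)) ∧
    -- Grassmann
    (∀ (k : ℕ) (V : Type u) [AddCommGroup V] [Module ℂ V] [FiniteDimensional ℂ V]
      (c : InnerProductSpace.Core ℂ (⨂[ℂ] _ : Fin k, V)),
      3 ≤ k → k + 3 ≤ Module.finrank ℂ V →
      2 < XRank.genericRank c (XRank.grassmann V k) →
      XRank.BestApproxFails c (XRank.grassmann V k)) ∧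
    -- Segre-Veronese
    (∀ (m : ℕ) (d : Fin m → ℕ) (V : Fin m → Type u) [∀ i, AddCommGroup (V i)]
      [∀ i, Module ℂ (V i)] [∀ i, FiniteDimensional ℂ (V i)]
      (c : InnerProductSpace.Core ℂ (⨂[ℂ] i, ⨂[ℂ] _ : Fin (d i), V i)),
      3 ≤ m → (∀ i, 1 ≤ d i) → (∀ i, 2 ≤ Module.finrank ℂ (V i)) →
      2 < XRank.genericRank c (XRank.segreVeronese V d) →
      XRank.BestApproxFails c (XRank.segreVeronese V d)) ∧
    -- Segre-Chow
    (∀ (m : ℕ) (d : Fin m → ℕ) (V : Fin m → Type u) [∀ i, AddCommGroup (V i)]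
      [∀ i, Module ℂ (V i)] [∀ i, FiniteDimensional ℂ (V i)]
      (c : InnerProductSpace.Core ℂ (⨂[ℂ] i, ⨂[ℂ] _ : Fin (d i), V i)),
      3 ≤ m → (∀ i, 1 ≤ d i) → (∀ i, 2 ≤ Module.finrank ℂ (V i)) →
      2 < XRank.genericRank c (XRank.segreChow V d) →
      XRank.BestApproxFails c (XRank.segreChow V d)) ∧
    -- Segre-Grassmann
    (∀ (m : ℕ) (k : Fin m → ℕ) (V : Fin m → Type u) [∀ i, AddCommGroup (V i)]
      [∀ i, Module ℂ (V i)] [∀ i, FiniteDimensional ℂ (V i)]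
      (c : InnerProductSpace.Core ℂ (⨂[ℂ] i, ⨂[ℂ] _ : Fin (k i), V i)),
      3 ≤ m → (∀ i, 1 ≤ k i) → (∀ i, k i < Module.finrank ℂ (V i)) →
      2 < XRank.genericRank c (XRank.segreGrassmann V k) →
      XRank.BestApproxFails c (XRank.segreGrassmann V k)) ∧
    -- Veronese-Chow
    (∀ (d k : ℕ) (V : Type u) [AddCommGroup V] [Module ℂ V] [FiniteDimensional ℂ V]
      (c : InnerProductSpace.Core ℂ (⨂[ℂ] _ : Fin k, ⨂[ℂ] _ : Fin d, V)),
      3 ≤ d → 3 ≤ k →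
      2 < XRank.genericRank c (XRank.veroneseChow V d k) →
      XRank.BestApproxFails c (XRank.veroneseChow V d k)) ∧
    -- Veronese-Grassmann
    (∀ (d k : ℕ) (V : Type u) [AddCommGroup V] [Module ℂ V] [FiniteDimensional ℂ V]
      (c : InnerProductSpace.Core ℂ (⨂[ℂ] _ : Fin d, ⨂[ℂ] _ : Fin k, V)),
      3 ≤ d → 3 ≤ k →
      2 < XRank.genericRank c (XRank.veroneseGrassmann V d k) →
      XRank.BestApproxFails c (XRank.veroneseGrassmann V d k)) ∧
    -- Segre-Veronese-Chow
    (∀ (m : ℕ) (d k : Fin m → ℕ) (V : Fin m → Type u) [∀ i, AddCommGroup (V i)]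
      [∀ i, Module ℂ (V i)] [∀ i, FiniteDimensional ℂ (V i)]
      (c : InnerProductSpace.Core ℂ (⨂[ℂ] i, ⨂[ℂ] _ : Fin (k i), ⨂[ℂ] _ : Fin (d i), V i)),
      3 ≤ m → (∀ i, 1 ≤ d i) → (∀ i, 1 ≤ k i) → (∀ i, 2 ≤ Module.finrank ℂ (V i)) →
      2 < XRank.genericRank c (XRank.segreVeroneseChow V d k) →
      XRank.BestApproxFails c (XRank.segreVeroneseChow V d k)) ∧
    -- Segre-Veronese-Grassmann
    (∀ (m : ℕ) (d k : Fin m → ℕ) (V : Fin m → Type u) [∀ i, AddCommGroup (V i)]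
      [∀ i, Module ℂ (V i)] [∀ i, FiniteDimensional ℂ (V i)]
      (c : InnerProductSpace.Core ℂ (⨂[ℂ] i, ⨂[ℂ] _ : Fin (d i), ⨂[ℂ] _ : Fin (k i), V i)),
      3 ≤ m → (∀ i, 1 ≤ d i) → (∀ i, 1 ≤ k i) → (∀ i, k i < Module.finrank ℂ (V i)) →
      2 < XRank.genericRank c (XRank.segreVeroneseGrassmann V d k) →
      XRank.BestApproxFails c (XRank.segreVeroneseGrassmann V d k)) := by
  exact ⟨fun _ _ _ _ _ c hd hV hg => XRank.bestApproxFails_segre c hd hV hg,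
    fun _ _ _ _ _ c hd hg => XRank.bestApproxFails_veronese c hd hg,
    fun _ _ _ _ _ c hd h3 hg => XRank.bestApproxFails_chow c hd h3 hg,
    fun _ _ _ _ _ c hk hV hg => XRank.bestApproxFails_grassmann c hk hV hg,
    fun _ _ _ _ _ _ c hm hd hV hg => XRank.bestApproxFails_segreVeronese c hm hd hV hg,
    fun _ _ _ _ _ _ c hm hd hV hg => XRank.bestApproxFails_segreChow c hm hd hV hg,
    fun _ _ _ _ _ _ c hm hk hV hg => XRank.bestApproxFails_segreGrassmann c hm hk hV hg,
    fun _ _ _ _ _ _ c hd hk hg => XRank.bestApproxFails_veroneseChow c hd hk hg,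
    fun _ _ _ _ _ _ c hd hk hg => XRank.bestApproxFails_veroneseGrassmann c hd hk hg,
    fun _ _ _ _ _ _ _ c hm hd hk hV hg =>
      XRank.bestApproxFails_segreVeroneseChow c hm hd hk hV hg,
    fun _ _ _ _ _ _ _ c hm hd hk hV hg =>
      XRank.bestApproxFails_segreVeroneseGrassmann c hm hd hk hV hg⟩
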